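/- **Setting.** Let $n\in\{2,3\}$ and let a bounded domain $Y\subset\mathbb R^n$ be decomposed, up to a set of $\mathcal H^{n-1}$-measure zero (e.g. tips of immersed fractures), into finitely many pairwise disjoint flat subdomains $\Omega_i^d$, $i\in I^d$, $0\le d\le n$, where $\Omega_i^d$ is a relatively open subset of a $d$-dimensional affine subspace. For $0\le d<n$ let $\Gamma_{ij}^d$, $j\in J_i^d$, be the interfaces between $\Omega_i^d$ and the adjacent subdomains of dimension $d+1$ (one interface for each side from which $\Omega_i^d$ is touched; geometrically $\Gamma^d_{ij}$ coincides with $\Omega^d_i$), with normal $\nu$ pointing out of the $(d+1)$-dimensional subdomain. Let $\partial Y$ be split into disjoint parts, a pressure part of positive measure and a no-flux part; immersed tips may be added to the no-flux part. On each subdomain of dimension $\ge1$ let $K$ be a constant symmetric positive definite tensor, and on each interface let $K_\nu,\gamma>0$ be constants. Each subdomain carries a simplicial mesh that resolves interfaces and boundary parts, and each interface an independent simplicial mortar mesh. Let $V_{0h}$ be the lowest-order Raviart–Thomas fields on the subdomains of dimension $\ge 1$ (normal components continuous across facets inside a subdomain) with zero normal component on the no-flux boundary and on all interfaces; let $\Lambda_h$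 be the piecewise constants on the mortar meshes, $Q_h$ the piecewise constants on the subdomain meshes, and $W_h=V_{0h}\times\Lambda_h$. For $\mu\in\Lambda_h$ let $R_h\mu$ be the piecewise Raviart–Thomas field whose normal component is, on facets on interfaces, the $L^2$-projection of $\mu$ onto the functions constant on each such facet, and $0$ on all other facets; let $[\![\mu]\!]=-\sum_{j\in J_i^d}\mu_{ij}$ on $\Omega_i^d$. For $w=[u_0,\lambda]$, $r=[v_0,\mu]\in W_h$ and $q\in Q_h$ put $$a(w,r)=(K^{-1}(u_0+R_h\lambda),v_0+R_h\mu)_\Omega+(\gamma K_\nu^{-1}\lambda,\mu)_\Gamma,\qquad b(r,q)=-(q,\nabla\cdot(v_0+R_h\mu)+[\![\mu]\!])_\Omega ,$$ and let $a^D$ be $a$ with $(K^{-1}u,v)_\Omega$ replaced by $\sum_T\sum_{f\subset\partial T}(u\cdot\nu_f)(v\cdot\nu_f)(K^{-1}\phi_f,\phi_f)_T$, where $T$ runs over all cells of dimension $\ge1$, $f$ over the facets of $T$, and $\phi_f$ is the local Raviart–Thomas basis field with normal component $1$ on $f$ and $0$ on the other facets. Define $A,D_A:W_h\to W_h'$ and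 $B:W_h\to Q_h'$ by $\langle Aw,r\rangle=a(w,r)$, $\langle D_Aw,r\rangle=a^D(w,r)$, $\langle Br,q\rangle=b(r,q)$, and $$\mathcal A=\begin{pmatrix}A&B^T\\-B&0\end{pmatrix},\qquad \mathcal M_D=\begin{pmatrix}H_w&0\\0&H_p\end{pmatrix},\qquad \mathcal M_U=\begin{pmatrix}H_w^{-1}&B^T\\0&H_p^{-1}\end{pmatrix}^{-1},$$ where $H_w:W_h'\to W_h$ and $H_p:Q_h'\to Q_h$ are symmetric positive definite. For $x',y'\in W_h'\times Q_h'$ write $(x',y')_{\mathcal M_D}=\langle x',\mathcal M_Dy'\rangle$ and $\|x'\|_{\mathcal M_D}^2=(x',x')_{\mathcal M_D}$. **Theorem.** Let $c_{1,w},c_{2,w},c_{1,p},c_{2,p}>0$, $0\le\rho<1$, $\sigma$ and $\kappa$ be given. There are constants $\xi_1,\xi_2>0$ depending only on these numbers and on $n$ such that the following holds for all decompositions, parameters $K,K_\nu,\gamma$ and meshes as above for which every subdomain cell $T$ of dimension $\ge1$ contains a ball of some radius $r>0$ (of its own dimension) with $\operatorname{diam}T\le\sigma r$, and on every subdomain the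 ratio of the largest to the smallest eigenvalue of $K$ is at most $\kappa$ ($\kappa=1$ being the case of scalar $K$). If $$c_{1,w}\langle f,H_wf\rangle\le\langle f,A^{-1}f\rangle\le c_{2,w}\langle f,H_wf\rangle\quad\forall f\in W_h',$$ $$c_{1,p}\langle g,H_pg\rangle\le\langle g,(BD_A^{-1}B^T)^{-1}g\rangle\le c_{2,p}\langle g,H_pg\rangle\quad\forall g\in Q_h',$$ and $\|I-H_wA\|_A\le\rho$ (the operator norm induced by $\|w\|_A=\langle Aw,w\rangle^{1/2}$), then the block operator defining $\mathcal M_U$ is invertible, and for every $x'=\mathcal M_U^{-1}x$ with $x\in W_h\times Q_h$, $x\ne0$, $$\xi_1\le\frac{(\mathcal A\mathcal M_Ux',x')_{\mathcal M_D}}{(x',x')_{\mathcal M_D}},\qquad \frac{\|\mathcal A\mathcal M_Ux'\|_{\mathcal M_D}}{\|x'\|_{\mathcal M_D}}\le\xi_2 .$$ In particular $\xi_1,\xi_2$ do not depend on the mesh sizes, on the magnitudes and jumps of $K$, or on $K_\nu$ and $\gamma$. -/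

import Mathlib

open MeasureTheory Module
open scoped Topology

noncomputable section

namespace FracturedFlow

/-! ## Simplices and the lowest-order Raviart--Thomas space -/

/-- Euclidean space of dimension `d`. -/
abbrev Vec (d : ℕ) := EuclideanSpace ℝ (Fin d)

/-- A nondegenerate `d`-simplex in `ℝ^d`, given by its affinely independent vertices. -/
abbrev Cell (d : ℕ) := Affine.Simplex ℝ (Vec d) d

/-- The closed simplex as a set of points. -/
def Cell.set {d : ℕ} (T : Cell d) : Set (Vec d) := convexHull ℝ (Set.range T.points)

/-- The closed facet of a simplex opposite to the vertex `f`. -/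
def Cell.facet {d : ℕ} (T : Cell d) (f : Fin (d + 1)) : Set (Vec d) :=
  convexHull ℝ (T.points '' {f}ᶜ)

/-- The relatively open facet of a simplex opposite to the vertex `f`. -/
def Cell.openFacet {d : ℕ} (T : Cell d) (f : Fin (d + 1)) : Set (Vec d) :=
  intrinsicInterior ℝ (T.facet f)

/-- The outward unit normal on the facet opposite to `f`: the altitude points from the vertex
to its foot on the facet. -/
def Cell.normal {d : ℕ} (T : Cell (d + 1)) (f : Fin (d + 2)) : Vec (d + 1) :=
  (T.height f)⁻¹ • (T.altitudeFoot f - T.points f)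

/-- The local space `ℙ₀^d + x ℙ₀` of lowest-order Raviart--Thomas fields on `ℝ^d`. -/
def RT0 (d : ℕ) : Submodule ℝ (Vec d → Vec d) where
  carrier := {v | ∃ (m : Vec d) (s : ℝ), ∀ x, v x = m + s • x}
  add_mem' := by
    rintro u v ⟨m, s, hu⟩ ⟨m', s', hv⟩
    exact ⟨m + m', s + s', fun x => by simp only [Pi.add_apply, hu, hv, add_smul]; abel⟩
  zero_mem' := ⟨0, 0, fun x => by simp⟩
  smul_mem' := by
    rintro c v ⟨m, s, hv⟩
    exact ⟨c • m, c * s, fun x => by simp only [Pi.smul_apply, hv, smul_add, mul_smul]⟩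

lemma contDiff_of_RT0 {d : ℕ} (v : RT0 d) : ContDiff ℝ 1 (v : Vec d → Vec d) := by
  obtain ⟨v, m, s, hv⟩ := v
  obtain rfl : v = fun x => m + s • x := funext hv
  change ContDiff ℝ 1 fun x => m + s • x
  fun_prop

lemma Cell.isCompact_set {d : ℕ} (T : Cell d) : IsCompact T.set :=
  (Set.finite_range T.points).isCompact_convexHull (𝕜 := ℝ)

/-- The Raviart--Thomas basis field of the facet opposite to `f`: its normal component is `1` on
that facet and `0` on all other facets. -/
def Cell.basisField {d : ℕ} (T : Cell (d + 1)) (f : Fin (d + 2)) : RT0 (d + 1) :=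
  ⟨fun x => (T.height f)⁻¹ • (x - T.points f),
    -((T.height f)⁻¹ • T.points f), (T.height f)⁻¹, fun x => by simp only [smul_sub]; abel⟩

/-- The (constant) outward normal component of a Raviart--Thomas field on the facet opposite
to `f`, evaluated at the centroid of that facet. -/
def Cell.normalComp {d : ℕ} (T : Cell (d + 1)) (f : Fin (d + 2)) : RT0 (d + 1) →ₗ[ℝ] ℝ where
  toFun v := inner ℝ ((v : Vec (d + 1) → Vec (d + 1)) (T.faceOppositeCentroid f)) (T.normal f)
  map_add' u v := by simp [inner_add_left]
  map_smul' c v := by simp [real_inner_smul_left]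

/-- The divergence of a vector field. -/
def divergence {d : ℕ} (v : Vec d → Vec d) (x : Vec d) : ℝ :=
  LinearMap.trace ℝ (Vec d) (fderiv ℝ v x : Vec d →ₗ[ℝ] Vec d)

lemma integrableOn_div_of_RT0 {d : ℕ} (v : RT0 d) (T : Cell d) :
    IntegrableOn (divergence (v : Vec d → Vec d)) T.set := by
  refine ContinuousOn.integrableOn_compact T.isCompact_set (Continuous.continuousOn ?_)
  have h : Continuous (fderiv ℝ (v : Vec d → Vec d)) := (contDiff_of_RT0 v).continuous_fderiv (by simp)
  exact ((LinearMap.trace ℝ (Vec d)).comp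
    (ContinuousLinearMap.coeLM ℝ)).continuous_of_finiteDimensional.comp h

/-- `∫_T ∇·v` as a linear functional. -/
def Cell.intDiv {d : ℕ} (T : Cell d) : RT0 d →ₗ[ℝ] ℝ where
  toFun v := ∫ x in T.set, divergence (v : Vec d → Vec d) x
  map_add' u v := by
    rw [← integral_add (integrableOn_div_of_RT0 u T) (integrableOn_div_of_RT0 v T)]
    congr 1; ext x
    have hu := ((contDiff_of_RT0 u).differentiable (by simp)) x
    have hv := ((contDiff_of_RT0 v).differentiable (by simp)) x
    simp [divergence, fderiv_add hu hv]
  map_smul' c v := by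
    rw [RingHom.id_apply, smul_eq_mul, ← integral_const_mul]
    congr 1; ext x
    have hv := ((contDiff_of_RT0 v).differentiable (by simp)) x
    simp [divergence, fderiv_const_smul hv c]

/-- The integrand `K⁻¹ u · v`. -/
def weighted {d : ℕ} (K : Matrix (Fin d) (Fin d) ℝ) (u v : Vec d → Vec d) (x : Vec d) : ℝ :=
  inner ℝ (Matrix.toEuclideanLin K⁻¹ (u x)) (v x)

lemma integrableOn_weighted_of_RT0 {d : ℕ} (K : Matrix (Fin d) (Fin d) ℝ) (u v : RT0 d) (T : Cell d) :
    IntegrableOn (weighted K (u : Vec d → Vec d) (v : Vec d → Vec d)) T.set := by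
  refine ContinuousOn.integrableOn_compact T.isCompact_set (Continuous.continuousOn ?_)
  exact (((Matrix.toEuclideanLin K⁻¹).continuous_of_finiteDimensional.comp
    (contDiff_of_RT0 u).continuous).inner (contDiff_of_RT0 v).continuous)

/-- The element form `(K⁻¹ u, v)_T = ∫_T K⁻¹ u · v`. -/
def Cell.fluxForm {d : ℕ} (K : Matrix (Fin d) (Fin d) ℝ) (T : Cell d) :
    RT0 d →ₗ[ℝ] RT0 d →ₗ[ℝ] ℝ :=
  LinearMap.mk₂ ℝ
    (fun u v => ∫ x in T.set, weighted K (u : Vec d → Vec d) (v : Vec d → Vec d) x)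
    (fun u u' v => by
      rw [← integral_add (integrableOn_weighted_of_RT0 K u v T) (integrableOn_weighted_of_RT0 K u' v T)]
      congr 1; ext x; simp [weighted, inner_add_left])
    (fun c u v => by
      rw [smul_eq_mul, ← integral_const_mul]
      congr 1; ext x; simp [weighted, real_inner_smul_left])
    (fun u v v' => by
      rw [← integral_add (integrableOn_weighted_of_RT0 K u v T) (integrableOn_weighted_of_RT0 K u v' T)]
      congr 1; ext x; simp [weighted, inner_add_right])
    (fun c u v => by
      rw [smul_eq_mul, ← integral_const_mul]
      congr 1; ext x; simp [weighted, real_inner_smul_right])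

/-- The diagonal element form
`(K⁻¹ u, v)_{D,T} = ∑_f (u·ν_f) (v·ν_f) (K⁻¹ φ_f, φ_f)_T`. -/
def Cell.diagFluxForm {d : ℕ} (K : Matrix (Fin (d + 1)) (Fin (d + 1)) ℝ) (T : Cell (d + 1)) :
    RT0 (d + 1) →ₗ[ℝ] RT0 (d + 1) →ₗ[ℝ] ℝ :=
  LinearMap.mk₂ ℝ
    (fun u v => ∑ f : Fin (d + 2), T.normalComp f u * T.normalComp f v *
      T.fluxForm K (T.basisField f) (T.basisField f))
    (fun u u' v => by simp [add_mul, Finset.sum_add_distrib])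
    (fun c u v => by simp [Finset.mul_sum, mul_assoc])
    (fun u v v' => by simp [mul_add, add_mul, Finset.sum_add_distrib])
    (fun c u v => by
      simp only [map_smul, smul_eq_mul, Finset.mul_sum]
      exact Finset.sum_congr rfl fun f _ => by ring)

/-! ## Mixed-dimensional geometry -/

/-- `ν` is the unit normal of an interface between the `d`-dimensional piece `ω`, placed in `ℝ^n`
by `e`, and the `(d+1)`-dimensional piece `ω'`, placed by `e'`: it is tangent to `ω'`, normal to
`ω`, and `ω'` lies on the side `-ν` of `ω` (so `ν` points out of `ω'`). -/
def IsSide {n d : ℕ} (ω : Set (Vec d)) (e : Vec d →ᵃⁱ[ℝ] Vec n)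
    (ω' : Set (Vec (d + 1))) (e' : Vec (d + 1) →ᵃⁱ[ℝ] Vec n) (ν : Vec (d + 1)) : Prop :=
  ‖ν‖ = 1 ∧
  (∀ y : Vec d, inner ℝ (e'.linearIsometry ν) (e.linearIsometry y) = 0) ∧
  ∀ x ∈ ω, ∀ᶠ t : ℝ in 𝓝[>] 0, e x - t • e'.linearIsometry ν ∈ e' '' ω'

/-- A mixed-dimensional decomposition of a fractured domain of dimension `n`.
The subdomain `Ω_i^d` (`i ∈ I d`) is flat: it is the image `emb d i '' Ω d i` of an open set of
`ℝ^d` under an affine isometry, so that `I d` is empty for `d > n`. -/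
structure Geometry (n : ℕ) where
  /-- the bulk domain, fractures included -/
  Y : Set (Vec n)
  isOpen_Y : IsOpen Y
  isConnected_Y : IsConnected Y
  isBounded_Y : Bornology.IsBounded Y
  /-- index set of the `d`-dimensional subdomains -/
  I : ℕ → Type
  fintypeI : ∀ d, Fintype (I d)
  Ω : ∀ d, I d → Set (Vec d)
  emb : ∀ d, I d → (Vec d →ᵃⁱ[ℝ] Vec n)
  isOpen_Ω : ∀ d i, IsOpen (Ω d i)
  nonempty_Ω : ∀ d i, (Ω d i).Nonempty
  Ω_subset : ∀ d i, emb d i '' Ω d i ⊆ Y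
  Ω_disjoint : ∀ a b : (Σ d, I d), a ≠ b →
    Disjoint (emb a.1 a.2 '' Ω a.1 a.2) (emb b.1 b.2 '' Ω b.1 b.2)
  /-- the subdomains exhaust the domain up to sets of dimension at most `n - 2`
  (for example the tips of fractures that end inside the domain) -/
  Ω_exhaust : μHE[n - 1] (Y \ ⋃ a : (Σ d, I d), emb a.1 a.2 '' Ω a.1 a.2) = 0
  /-- index set of the interfaces `Γ_ij^d` between `Ω_i^d` and the adjacent subdomains of dimension
  `d + 1`; each of them occupies the same place as `Ω_i^d`, and a subdomain that touches `Ω_i^d`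
  from two sides gives two interfaces -/
  J : ∀ d, I d → Type
  fintypeJ : ∀ d i, Fintype (J d i)
  /-- the adjacent `(d+1)`-dimensional subdomain -/
  nbr : ∀ d i, J d i → I (d + 1)
  /-- the unit normal on the interface that points out of the adjacent subdomain -/
  nrm : ∀ d i, J d i → Vec (d + 1)
  side_iff : ∀ d i k ν, IsSide (Ω d i) (emb d i) (Ω (d + 1) k) (emb (d + 1) k) ν ↔
    ∃ j, nbr d i j = k ∧ nrm d i j = ν
  side_inj : ∀ d i j j', nbr d i j = nbr d i j' → nrm d i j = nrm d i j' → j = j'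
  /-- the part of the boundary with prescribed pressure -/
  bdryD : Set (Vec n)
  /-- the part of the boundary with zero flux; it may also contain immersed fracture tips -/
  bdryN : Set (Vec n)
  bdryD_subset : bdryD ⊆ frontier Y
  frontier_subset : frontier Y ⊆ bdryD ∪ bdryN
  bdry_disjoint : Disjoint bdryD bdryN
  bdryN_disjoint : ∀ d i, Disjoint bdryN (emb d i '' Ω d i)
  bdryD_pos : 0 < μHE[n - 1] bdryD

attribute [instance] Geometry.fintypeI Geometry.fintypeJ

/-- Physical parameters, constant on each subdomain and each interface: the symmetric positive
definite permeability tensors `K` on the subdomains of dimension `d + 1 ≥ 1`, the normal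
permeabilities `Kν` and the lengths `γ` (apertures) on the interfaces. -/
structure Params {n : ℕ} (G : Geometry n) where
  K : ∀ d, G.I (d + 1) → Matrix (Fin (d + 1)) (Fin (d + 1)) ℝ
  K_posDef : ∀ d k, (K d k).PosDef
  Kν : ∀ d i, G.J d i → ℝ
  Kν_pos : ∀ d i j, 0 < Kν d i j
  γ : ∀ d i, G.J d i → ℝ
  γ_pos : ∀ d i j, 0 < γ d i j

/-- On each subdomain the quotient of the largest and the smallest eigenvalue of `K` is at
most `κ`. No relation between different subdomains is required; for `κ = 1` the tensors are
arbitrary positive scalars. -/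
def Params.AnisotropyLE {n : ℕ} {G : Geometry n} (P : Params G) (κ : ℝ) : Prop :=
  ∀ d k, ∃ m : ℝ, 0 < m ∧ ∀ ξ : Vec (d + 1),
    m * ‖ξ‖ ^ 2 ≤ inner ℝ (Matrix.toEuclideanLin (P.K d k) ξ) ξ ∧
    inner ℝ (Matrix.toEuclideanLin (P.K d k) ξ) ξ ≤ κ * m * ‖ξ‖ ^ 2

/-! ## Meshes -/

/-- A conforming simplicial triangulation of an open set `ω ⊆ ℝ^d`. Cells that meet only in
the boundary of `ω` (across a slit) need not match. -/
structure Triangulation {d : ℕ} (ω : Set (Vec d)) where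
  cells : Finset (Cell d)
  interior_subset : ∀ T ∈ cells, interior T.set ⊆ ω
  cover : ⋃ T ∈ cells, T.set = closure ω
  disjoint_interior : ∀ S ∈ cells, ∀ T ∈ cells, S ≠ T → Disjoint (interior S.set) (interior T.set)
  conforming : ∀ S ∈ cells, ∀ T ∈ cells, (S.set ∩ T.set ∩ ω).Nonempty →
    S.set ∩ T.set = convexHull ℝ (Set.range S.points ∩ Set.range T.points)

/-- The facet of a cell `T` of the `k`-th subdomain of dimension `d + 1` that is opposite to the
vertex `f` lies on the interface `Γ_ij^d`. -/
def Geometry.OnSide {n : ℕ} (G : Geometry n) (d : ℕ) (k : G.I (d + 1)) (T : Cell (d + 1))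
    (f : Fin (d + 2)) (i : G.I d) (j : G.J d i) : Prop :=
  G.nbr d i j = k ∧ T.normal f = G.nrm d i j ∧
    G.emb (d + 1) k '' T.openFacet f ⊆ G.emb d i '' G.Ω d i

/-- Simplicial meshes of all subdomains, resolving interfaces and boundary parts, and independent
mortar meshes of all interfaces. -/
structure Discretization {n : ℕ} (G : Geometry n) where
  mesh : ∀ d (i : G.I d), Triangulation (G.Ω d i)
  mortar : ∀ d (i : G.I d), G.J d i → Triangulation (G.Ω d i)
  facet_fit : ∀ d (k : G.I (d + 1)), ∀ T ∈ (mesh (d + 1) k).cells, ∀ f : Fin (d + 2),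
    T.openFacet f ⊆ G.Ω (d + 1) k ∨
    (∃ i j, G.OnSide d k T f i j) ∨
    G.emb (d + 1) k '' T.openFacet f ⊆ G.bdryD ∨
    G.emb (d + 1) k '' T.openFacet f ⊆ G.bdryN

/-- Shape regularity of the subdomain meshes: each cell contains a ball whose radius is at least
`1/σ` times the diameter of the cell. -/
def Discretization.ShapeRegular {n : ℕ} {G : Geometry n} (𝒯 : Discretization G) (σ : ℝ) : Prop :=
  ∀ d (k : G.I (d + 1)), ∀ T ∈ (𝒯.mesh (d + 1) k).cells, ∃ (c : Vec (d + 1)) (r : ℝ),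
    0 < r ∧ Metric.closedBall c r ⊆ T.set ∧ Metric.diam T.set ≤ σ * r

/-! ## Discrete spaces -/

section Spaces

variable {n : ℕ} {G : Geometry n} (𝒯 : Discretization G)

/-- Piecewise (broken) Raviart--Thomas fields on the subdomains of dimension `d + 1 ≥ 1`. -/
abbrev Broken :=
  (d : ℕ) → (k : G.I (d + 1)) → ↥(𝒯.mesh (d + 1) k).cells → ↥(RT0 (d + 1))

/-- `V_h`: Raviart--Thomas fields with continuous normal component across the facets inside each
subdomain (so with divergence in `L²` of each subdomain) and zero normal component on the no-flux
boundary. -/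
def Vh : Submodule ℝ (Broken 𝒯) where
  carrier := {v |
    (∀ d k (S T : ↥(𝒯.mesh (d + 1) k).cells) (f g : Fin (d + 2)), S ≠ T →
      S.1.facet f = T.1.facet g → S.1.openFacet f ⊆ G.Ω (d + 1) k →
      S.1.normalComp f (v d k S) + T.1.normalComp g (v d k T) = 0) ∧
    (∀ d k (T : ↥(𝒯.mesh (d + 1) k).cells) (f : Fin (d + 2)),
      G.emb (d + 1) k '' T.1.openFacet f ⊆ G.bdryN → T.1.normalComp f (v d k T) = 0)}
  add_mem' := by
    rintro u v ⟨hu, hu'⟩ ⟨hv, hv'⟩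
    refine ⟨fun d k S T f g h1 h2 h3 => ?_, fun d k T f h => ?_⟩
    · have e1 := hu d k S T f g h1 h2 h3
      have e2 := hv d k S T f g h1 h2 h3
      simp only [Pi.add_apply, map_add]
      linarith
    · simp [hu' d k T f h, hv' d k T f h]
  zero_mem' := by simp
  smul_mem' := by
    rintro c v ⟨hv, hv'⟩
    refine ⟨fun d k S T f g h1 h2 h3 => ?_, fun d k T f h => ?_⟩
    · have e2 := hv d k S T f g h1 h2 h3
      simp only [Pi.smul_apply, map_smul, smul_eq_mul, ← mul_add, e2, mul_zero]
    · simp [hv' d k T f h]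

/-- Fields with zero normal component on all interfaces. -/
def noInterfaceFlux : Submodule ℝ (Broken 𝒯) where
  carrier := {v | ∀ d k (T : ↥(𝒯.mesh (d + 1) k).cells) (f : Fin (d + 2)) i j,
      G.OnSide d k T.1 f i j → T.1.normalComp f (v d k T) = 0}
  add_mem' := by
    intro u v hu hv d k T f i j h
    simp [hu d k T f i j h, hv d k T f i j h]
  zero_mem' := by intro d k T f i j _; simp
  smul_mem' := by
    intro c v hv d k T f i j h
    simp [hv d k T f i j h]

/-- `V_{0h}`: the fields of `V_h` with zero normal component on all interfaces. -/
def V0h : Submodule ℝ (Broken 𝒯) := Vh 𝒯 ⊓ noInterfaceFlux 𝒯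

/-- `Λ_h`: piecewise constants on the mortar meshes. -/
abbrev Lambdah :=
  (d : ℕ) → (i : G.I d) → (j : G.J d i) → ↥(𝒯.mortar d i j).cells → ℝ

/-- `Q_h`: piecewise constants on the subdomain meshes. -/
abbrev Qh := (d : ℕ) → (i : G.I d) → ↥(𝒯.mesh d i).cells → ℝ

/-- `W_h = V_{0h} × Λ_h`. -/
abbrev Wh := ↥(V0h 𝒯) × Lambdah 𝒯

/-- The facet of a cell of the `k`-th `(d+1)`-dimensional subdomain, in the coordinates of
`Ω_i^d`. -/
def facetTrace (G : Geometry n) (d : ℕ) (k : G.I (d + 1)) (T : Cell (d + 1)) (f : Fin (d + 2))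
    (i : G.I d) : Set (Vec d) :=
  G.emb d i ⁻¹' (G.emb (d + 1) k '' T.facet f)

open Classical in
/-- The value on a facet of the piecewise constant `Π̂_h μ` (and `0` if the facet is on no
interface). The normal traces of `V_h` on an interface are all the functions that are constant on
each facet there, so the `L²` projection `Π̂_h μ` onto them is the mean value of `μ` over each
facet `F`, which is `∑_M μ_M |F ∩ M| / |F|` with `M` running over the mortar cells. -/
def projTrace (d : ℕ) (k : G.I (d + 1)) (T : Cell (d + 1)) (f : Fin (d + 2)) :
    Lambdah 𝒯 →ₗ[ℝ] ℝ where
  toFun μ := ∑ i : G.I d, ∑ j : G.J d i, if G.OnSide d k T f i j then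
    ∑ M : ↥(𝒯.mortar d i j).cells, μ d i j M *
      (volume.real (facetTrace G d k T f i ∩ M.1.set) / volume.real (facetTrace G d k T f i))
    else 0
  map_add' μ μ' := by
    simp only [← Finset.sum_add_distrib]
    refine Finset.sum_congr rfl fun i _ => Finset.sum_congr rfl fun j _ => ?_
    split_ifs <;> simp [add_mul, Finset.sum_add_distrib]
  map_smul' c μ := by
    simp only [RingHom.id_apply, smul_eq_mul, Finset.mul_sum]
    refine Finset.sum_congr rfl fun i _ => Finset.sum_congr rfl fun j _ => ?_
    split_ifs <;> simp [Finset.mul_sum, mul_assoc]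

/-- The discrete extension `R_h`: the Raviart--Thomas field with normal component `Π̂_h μ` on the
facets on interfaces and `0` on all other facets. -/
def Rh : Lambdah 𝒯 →ₗ[ℝ] Broken 𝒯 where
  toFun μ := fun d k T => ∑ f : Fin (d + 2), projTrace 𝒯 d k T.1 f μ • T.1.basisField f
  map_add' μ μ' := by
    funext d k T
    simp [add_smul, Finset.sum_add_distrib]
  map_smul' c μ := by
    funext d k T
    simp [mul_smul, Finset.smul_sum]

/-- The total flux `v_0 + R_h μ` of `[v_0, μ] ∈ W_h`. -/
def totalFlux : Wh 𝒯 →ₗ[ℝ] Broken 𝒯 where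
  toFun r := (r.1 : Broken 𝒯) + Rh 𝒯 r.2
  map_add' r r' := by simp only [Prod.fst_add, Prod.snd_add, Submodule.coe_add, map_add]; abel
  map_smul' c r := by simp

/-- `∫_T ⟦μ⟧` over a cell `T` of `Ω_i^d`, where `⟦μ⟧ = -∑_j μ_ij` on `Ω_i^d`. -/
def intJump (d : ℕ) (i : G.I d) (T : Cell d) : Lambdah 𝒯 →ₗ[ℝ] ℝ where
  toFun μ := -∑ j : G.J d i, ∑ M : ↥(𝒯.mortar d i j).cells,
    μ d i j M * volume.real (T.set ∩ M.1.set)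
  map_add' μ μ' := by
    simp only [Pi.add_apply, add_mul, Finset.sum_add_distrib, neg_add]
  map_smul' c μ := by
    simp only [Pi.smul_apply, smul_eq_mul, mul_assoc, ← Finset.mul_sum, RingHom.id_apply, mul_neg]

/-! ## Bilinear forms and operators -/

variable (P : Params G)

/-- The mortar form `(γ Kν⁻¹ λ, μ)_Γ`. -/
def mortarForm : Lambdah 𝒯 →ₗ[ℝ] Lambdah 𝒯 →ₗ[ℝ] ℝ :=
  LinearMap.mk₂ ℝ
    (fun l μ => ∑ d ∈ Finset.range n, ∑ i : G.I d, ∑ j : G.J d i,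
      ∑ M : ↥(𝒯.mortar d i j).cells,
        P.γ d i j * (P.Kν d i j)⁻¹ * volume.real M.1.set * l d i j M * μ d i j M)
    (fun l l' μ => by simp only [Pi.add_apply, mul_add, add_mul, Finset.sum_add_distrib])
    (fun c l μ => by
      simp only [Pi.smul_apply, smul_eq_mul, Finset.mul_sum]
      refine Finset.sum_congr rfl fun _ _ => Finset.sum_congr rfl fun _ _ =>
        Finset.sum_congr rfl fun _ _ => Finset.sum_congr rfl fun _ _ => by ring)
    (fun l μ μ' => by simp only [Pi.add_apply, mul_add, Finset.sum_add_distrib])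
    (fun c l μ => by
      simp only [Pi.smul_apply, smul_eq_mul, Finset.mul_sum]
      refine Finset.sum_congr rfl fun _ _ => Finset.sum_congr rfl fun _ _ =>
        Finset.sum_congr rfl fun _ _ => Finset.sum_congr rfl fun _ _ => by ring)

/-- `(K⁻¹ u, v)_Ω` for piecewise Raviart--Thomas fields. -/
def bulkForm : Broken 𝒯 →ₗ[ℝ] Broken 𝒯 →ₗ[ℝ] ℝ :=
  LinearMap.mk₂ ℝ
    (fun u v => ∑ d ∈ Finset.range n, ∑ k : G.I (d + 1), ∑ T : ↥(𝒯.mesh (d + 1) k).cells,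
      T.1.fluxForm (P.K d k) (u d k T) (v d k T))
    (fun u u' v => by simp [Finset.sum_add_distrib])
    (fun c u v => by simp [Finset.mul_sum])
    (fun u v v' => by simp [Finset.sum_add_distrib])
    (fun c u v => by simp [Finset.mul_sum])

/-- `(K⁻¹ u, v)_{D,Ω}` for piecewise Raviart--Thomas fields. -/
def diagBulkForm : Broken 𝒯 →ₗ[ℝ] Broken 𝒯 →ₗ[ℝ] ℝ :=
  LinearMap.mk₂ ℝ
    (fun u v => ∑ d ∈ Finset.range n, ∑ k : G.I (d + 1), ∑ T : ↥(𝒯.mesh (d + 1) k).cells,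
      T.1.diagFluxForm (P.K d k) (u d k T) (v d k T))
    (fun u u' v => by simp [Finset.sum_add_distrib])
    (fun c u v => by simp [Finset.mul_sum])
    (fun u v v' => by simp [Finset.sum_add_distrib])
    (fun c u v => by simp [Finset.mul_sum])

/-- `A : W_h → W_h'`, `⟨A w, r⟩ = a(w, r)
= (K⁻¹(u_0 + R_h λ), v_0 + R_h μ)_Ω + (γ Kν⁻¹ λ, μ)_Γ`. -/
def opA : Wh 𝒯 →ₗ[ℝ] Dual ℝ (Wh 𝒯) :=
  (bulkForm 𝒯 P).compl₁₂ (totalFlux 𝒯) (totalFlux 𝒯) +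
    (mortarForm 𝒯 P).compl₁₂ (LinearMap.snd ℝ _ _) (LinearMap.snd ℝ _ _)

/-- `D_A : W_h → W_h'`, `⟨D_A w, r⟩ = a^D(w, r)
= (K⁻¹(u_0 + R_h λ), v_0 + R_h μ)_{D,Ω} + (γ Kν⁻¹ λ, μ)_Γ`. -/
def opDA : Wh 𝒯 →ₗ[ℝ] Dual ℝ (Wh 𝒯) :=
  (diagBulkForm 𝒯 P).compl₁₂ (totalFlux 𝒯) (totalFlux 𝒯) +
    (mortarForm 𝒯 P).compl₁₂ (LinearMap.snd ℝ _ _) (LinearMap.snd ℝ _ _)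

/-- `B : W_h → Q_h'`, `⟨B r, q⟩ = b(r, q) = -(q, ∇·(v_0 + R_h μ) + ⟦μ⟧)_Ω`; the divergence lives on
the subdomains of dimension `d + 1`, the jump on those of dimension `d`. -/
def opB : Wh 𝒯 →ₗ[ℝ] Dual ℝ (Qh 𝒯) :=
  LinearMap.mk₂ ℝ
    (fun r q =>
      -(∑ d ∈ Finset.range n, ∑ k : G.I (d + 1), ∑ T : ↥(𝒯.mesh (d + 1) k).cells,
          q (d + 1) k T * T.1.intDiv (totalFlux 𝒯 r d k T) +
        ∑ d ∈ Finset.range n, ∑ i : G.I d, ∑ T : ↥(𝒯.mesh d i).cells,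
          q d i T * intJump 𝒯 d i T.1 r.2))
    (fun r r' q => by
      simp only [map_add, Pi.add_apply, Prod.snd_add, mul_add, Finset.sum_add_distrib]; ring)
    (fun c r q => by
      simp only [map_smul, Pi.smul_apply, Prod.smul_snd, smul_eq_mul, mul_left_comm _ c,
        ← Finset.mul_sum]; ring)
    (fun r q q' => by
      simp only [Pi.add_apply, add_mul, Finset.sum_add_distrib]; ring)
    (fun c r q => by
      simp only [Pi.smul_apply, smul_eq_mul, mul_assoc, ← Finset.mul_sum]; ring)

/-- `Bᵀ : Q_h → W_h'`, `⟨Bᵀ q, r⟩ = b(r, q)`. -/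
def opBT : Qh 𝒯 →ₗ[ℝ] Dual ℝ (Wh 𝒯) := (opB 𝒯).flip

end Spaces

/-! ## Preconditioners -/

section Precond

variable {V V' : Type*} [AddCommMonoid V] [Module ℝ V] [AddCommMonoid V'] [Module ℝ V']

open Classical in
/-- The inverse of a bijective linear operator (and `0` for one that is not bijective). -/
def opInv (L : V →ₗ[ℝ] V') : V' →ₗ[ℝ] V :=
  if h : Function.Bijective L then (LinearEquiv.ofBijective L h).symm.toLinearMap else 0

/-- `H : V' → V` is symmetric positive definite. -/
def IsSPD (H : Dual ℝ V →ₗ[ℝ] V) : Prop :=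
  (∀ f g : Dual ℝ V, f (H g) = g (H f)) ∧ ∀ f : Dual ℝ V, f ≠ 0 → 0 < f (H f)

/-- `c₁ ⟨f, H f⟩ ≤ ⟨f, L⁻¹ f⟩ ≤ c₂ ⟨f, H f⟩` for all `f ∈ V'`. -/
def SpectrallyEquiv (c₁ c₂ : ℝ) (H : Dual ℝ V →ₗ[ℝ] V) (L : V →ₗ[ℝ] Dual ℝ V) : Prop :=
  ∀ f : Dual ℝ V, c₁ * f (H f) ≤ f (opInv L f) ∧ f (opInv L f) ≤ c₂ * f (H f)

/-- The norm `‖v‖_L = ⟨L v, v⟩^{1/2}` of a symmetric positive definite operator `L : V → V'`. -/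
def opNorm (L : V →ₗ[ℝ] Dual ℝ V) (v : V) : ℝ := Real.sqrt (L v v)

/-- The inner product `(x', y')_M = ⟨x', M y'⟩` on the dual `V' × U'` of `V × U`. -/
def dualInner {U : Type*} [AddCommMonoid U] [Module ℝ U]
    (M : (Dual ℝ V × Dual ℝ U) →ₗ[ℝ] V × U) (x y : Dual ℝ V × Dual ℝ U) : ℝ :=
  x.1 (M y).1 + x.2 (M y).2

/-- The norm `‖x'‖_M = (x', x')_M^{1/2}`. -/
def dualNorm {U : Type*} [AddCommMonoid U] [Module ℝ U]
    (M : (Dual ℝ V × Dual ℝ U) →ₗ[ℝ] V × U) (x : Dual ℝ V × Dual ℝ U) : ℝ :=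
  Real.sqrt (dualInner M x x)

variable {n : ℕ} {G : Geometry n} (𝒯 : Discretization G) (P : Params G)

/-- `B D_A⁻¹ Bᵀ : Q_h → Q_h'`. -/
def opS : Qh 𝒯 →ₗ[ℝ] Dual ℝ (Qh 𝒯) := opB 𝒯 ∘ₗ opInv (opDA 𝒯 P) ∘ₗ opBT 𝒯

/-- The saddle point operator `(w, p) ↦ (A w + Bᵀ p, -B w)`. -/
def saddle : (Wh 𝒯 × Qh 𝒯) →ₗ[ℝ] Dual ℝ (Wh 𝒯) × Dual ℝ (Qh 𝒯) :=
  ((opA 𝒯 P).coprod (opBT 𝒯)).prod ((-(opB 𝒯)).comp (LinearMap.fst ℝ _ _))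

/-- The block diagonal preconditioner `M_D = diag(H_w, H_p)`. -/
def precondD (Hw : Dual ℝ (Wh 𝒯) →ₗ[ℝ] Wh 𝒯) (Hp : Dual ℝ (Qh 𝒯) →ₗ[ℝ] Qh 𝒯) :
    (Dual ℝ (Wh 𝒯) × Dual ℝ (Qh 𝒯)) →ₗ[ℝ] Wh 𝒯 × Qh 𝒯 :=
  Hw.prodMap Hp

/-- The block upper triangular operator `(w, p) ↦ (H_w⁻¹ w + Bᵀ p, H_p⁻¹ p)`. -/
def upperBlock (Hw : Dual ℝ (Wh 𝒯) →ₗ[ℝ] Wh 𝒯) (Hp : Dual ℝ (Qh 𝒯) →ₗ[ℝ] Qh 𝒯) :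
    (Wh 𝒯 × Qh 𝒯) →ₗ[ℝ] Dual ℝ (Wh 𝒯) × Dual ℝ (Qh 𝒯) :=
  ((opInv Hw).coprod (opBT 𝒯)).prod ((opInv Hp).comp (LinearMap.snd ℝ _ _))

/-- The inexact block upper triangular preconditioner `M_U`, the inverse of `upperBlock`. -/
def precondU (Hw : Dual ℝ (Wh 𝒯) →ₗ[ℝ] Wh 𝒯) (Hp : Dual ℝ (Qh 𝒯) →ₗ[ℝ] Qh 𝒯) :
    (Dual ℝ (Wh 𝒯) × Dual ℝ (Qh 𝒯)) →ₗ[ℝ] Wh 𝒯 × Qh 𝒯 :=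
  opInv (upperBlock 𝒯 Hw Hp)

end Precond

end FracturedFlow

end

/-! Two facts carry the theorem: the exact mass form and its diagonal version are equivalent, and
this equivalence yields field-of-values bounds by Hilbert space algebra alone.

Equivalence of `opA` and `opDA`, up to a factor `β` = `equivConst n σ κ`. Both forms contain the
same mortar term, so the comparison is made cell by cell. A local field is the sum of its normal
components times the basis fields, and Cauchy–Schwarz bounds the full form by the number of facets
times the diagonal one, on any simplex (`Cell.fluxForm_le_diagFluxForm`). Conversely, a field `m + s
x` is uniformly large on a quarter-size ball inside the inscribed ball, which controls its normal
components on a shape regular cell (`Cell.diagFluxForm_le_fluxForm`). Each cell sees one tensor `K`,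
whose magnitude cancels; jumps of `K` and the interface parameters never enter.

Field of values (`saddle_fieldOfValues`). Put `w = Hw f`, `p = Hp e`, `g = Bᵀ p`, so that `x' = (f +
g, e)`. In the numerator the coupling terms `g w` cancel, leaving `⟨A w, w⟩ + ⟨A w, Hw g⟩ + ⟨g, Hw
g⟩`. The contraction hypothesis gives `A ≤ 2 Hw⁻¹`, so the cross term is absorbed by the two
squares. These squares control the norm of `x'`, since `⟨e, Hp e⟩` is comparable to `⟨g, D⁻¹ g⟩` and
hence, through `β`, to `⟨g, Hw g⟩`. The upper bound uses in addition `⟨B w, S⁻¹ B w⟩ ≤ ⟨D w, w⟩` for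
`S = B D⁻¹ Bᵀ` (`schur_apply_le`).

No inf-sup condition is proved: invertibility of `A` and `S` is already contained in the spectral
hypotheses (`SpectrallyEquiv.bijective`). -/

namespace FracturedFlow

/-! ## Symmetric operators and their inverses -/

section Abstract

variable {V : Type*} [AddCommGroup V] [Module ℝ V]

lemma opInv_apply_self {V' : Type*} [AddCommMonoid V'] [Module ℝ V'] {L : V →ₗ[ℝ] V'}
    (h : Function.Bijective L) (v : V) : opInv L (L v) = v := by
  rw [opInv, dif_pos h]
  exact (LinearEquiv.ofBijective L h).symm_apply_apply v

lemma apply_opInv {V' : Type*} [AddCommMonoid V'] [Module ℝ V'] {L : V →ₗ[ℝ] V'}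
    (h : Function.Bijective L) (f : V') : L (opInv L f) = f := by
  rw [opInv, dif_pos h]
  exact (LinearEquiv.ofBijective L h).apply_symm_apply f

/-- The Cauchy--Schwarz inequality for a symmetric positive semidefinite operator. -/
lemma apply_sq_le {L : V →ₗ[ℝ] Dual ℝ V} (hs : ∀ u v, L u v = L v u) (hp : ∀ v, 0 ≤ L v v)
    (u v : V) : L u v ^ 2 ≤ L u u * L v v := by
  have h := LinearMap.BilinForm.apply_mul_apply_le_of_forall_zero_le L hp u v
  rwa [hs v u, ← sq] at h

/-- Each comparison of inverses below squares a pairing by Cauchy–Schwarz and then cancels one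
factor of it in this way. -/
lemma le_mul_of_sq_le {x y c : ℝ} (hc : 0 ≤ c) (hx : 0 ≤ x) (hy : 0 ≤ y)
    (h : x ^ 2 ≤ c * x * y) : x ≤ c * y := by
  rcases hx.eq_or_lt with rfl | hx
  · positivity
  · exact le_of_mul_le_mul_left (by nlinarith) hx

lemma IsSPD.apply_nonneg {H : Dual ℝ V →ₗ[ℝ] V} (hH : IsSPD H) (f : Dual ℝ V) : 0 ≤ f (H f) := by
  rcases eq_or_ne f 0 with rfl | hf
  · simp
  · exact (hH.2 f hf).le

lemma IsSPD.apply_sq_le {H : Dual ℝ V →ₗ[ℝ] V} (hH : IsSPD H) (f g : Dual ℝ V) :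
    f (H g) ^ 2 ≤ f (H f) * g (H g) := by
  -- Composed with evaluation, `H` becomes a form on the dual space, to which the inequality for
  -- operators `V → V'` applies.
  let L : Dual ℝ V →ₗ[ℝ] Dual ℝ (Dual ℝ V) := (Dual.eval ℝ V).comp H
  have h := FracturedFlow.apply_sq_le (L := L) (fun u v => hH.1 v u) hH.apply_nonneg g f
  rw [mul_comm]
  exact h

lemma IsSPD.add_apply_le {H : Dual ℝ V →ₗ[ℝ] V} (hH : IsSPD H) (f g : Dual ℝ V) :
    (f + g) (H (f + g)) ≤ 2 * f (H f) + 2 * g (H g) := by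
  have h := hH.apply_nonneg (f - g)
  have hs := hH.1 f g
  simp only [map_sub, map_add, LinearMap.sub_apply, LinearMap.add_apply] at h ⊢
  linarith

lemma IsSPD.bijective [FiniteDimensional ℝ V] {H : Dual ℝ V →ₗ[ℝ] V} (hH : IsSPD H) :
    Function.Bijective H := by
  have hi : Function.Injective H := by
    rw [injective_iff_map_eq_zero]
    intro f hf
    by_contra h
    have := hH.2 f h
    simp [hf] at this
  exact ⟨hi, (LinearMap.injective_iff_surjective_of_finrank_eq_finrank
    Subspace.dual_finrank_eq).1 hi⟩

lemma bijective_of_pos [FiniteDimensional ℝ V] {L : V →ₗ[ℝ] Dual ℝ V}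
    (hL : ∀ v, v ≠ 0 → 0 < L v v) : Function.Bijective L := by
  have hi : Function.Injective L := by
    rw [injective_iff_map_eq_zero]
    intro v hv
    by_contra h
    have := hL v h
    simp [hv] at this
  exact ⟨hi, (LinearMap.injective_iff_surjective_of_finrank_eq_finrank
    Subspace.dual_finrank_eq.symm).1 hi⟩

/-- For a non-bijective `L`, `opInv L` is `0` by convention. The lower bound then contradicts
definiteness of `H` unless the dual is zero; but then `V` is zero too and `L` is bijective after
all. -/
lemma SpectrallyEquiv.bijective {c₁ c₂ : ℝ} {H : Dual ℝ V →ₗ[ℝ] V} {L : V →ₗ[ℝ] Dual ℝ V}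
    (hc₁ : 0 < c₁) (hH : IsSPD H) (h : SpectrallyEquiv c₁ c₂ H L) : Function.Bijective L := by
  by_contra hL
  have h0 : ∀ f : Dual ℝ V, f = 0 := fun f => by
    by_contra hf
    have h1 := (h f).1
    rw [opInv, dif_neg hL] at h1
    have := mul_pos hc₁ (hH.2 f hf)
    simp only [LinearMap.zero_apply, map_zero] at h1
    linarith
  have hV : ∀ v : V, v = 0 := fun v =>
    (forall_dual_apply_eq_zero_iff ℝ v).1 fun f => by rw [h0 f]; rfl
  exact hL ⟨fun u v _ => by rw [hV u, hV v], fun f => ⟨0, by rw [h0 f, map_zero]⟩⟩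

lemma SpectrallyEquiv.pos {c₁ c₂ : ℝ} {H : Dual ℝ V →ₗ[ℝ] V} {L : V →ₗ[ℝ] Dual ℝ V}
    (hc₁ : 0 < c₁) (hH : IsSPD H) (h : SpectrallyEquiv c₁ c₂ H L) {v : V} (hv : v ≠ 0) :
    0 < L v v := by
  have hb := h.bijective hc₁ hH
  have h1 := (h (L v)).1
  rw [opInv_apply_self hb] at h1
  refine lt_of_lt_of_le (mul_pos hc₁ (hH.2 _ fun h0 => hv ?_)) h1
  exact hb.1 (by rw [h0, map_zero])

/-- The bound `L⁻¹ ≤ c H` of operators on the dual gives `H⁻¹ ≤ c L`. -/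
lemma apply_le_of_opInv_le {c : ℝ} (hc : 0 ≤ c) {H : Dual ℝ V →ₗ[ℝ] V} {L : V →ₗ[ℝ] Dual ℝ V}
    (hH : IsSPD H) (hs : ∀ u v, L u v = L v u) (hp : ∀ v, 0 ≤ L v v)
    (hb : Function.Bijective L) (h : ∀ f : Dual ℝ V, f (opInv L f) ≤ c * f (H f))
    (f : Dual ℝ V) : f (H f) ≤ c * L (H f) (H f) := by
  -- Since `f = L (L⁻¹ f)`, the squared pairing on the left is `⟨f, H f⟩²`.
  have h1 := apply_sq_le hs hp (opInv L f) (H f)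
  rw [apply_opInv hb] at h1
  exact le_mul_of_sq_le hc (hH.apply_nonneg f) (hp _)
    (h1.trans (mul_le_mul_of_nonneg_right (h f) (hp _)))

/-- The bound `c H ≤ L⁻¹` of operators on the dual gives `c L ≤ H⁻¹`. -/
lemma mul_apply_le_of_le_opInv {c : ℝ} (hc : 0 < c) {H : Dual ℝ V →ₗ[ℝ] V}
    {L : V →ₗ[ℝ] Dual ℝ V} (hH : IsSPD H) (hp : ∀ v, 0 ≤ L v v) (hb : Function.Bijective L)
    (h : ∀ f : Dual ℝ V, c * f (H f) ≤ f (opInv L f)) (f : Dual ℝ V) :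
    c * L (H f) (H f) ≤ f (H f) := by
  -- Here Cauchy–Schwarz is taken in the inner product of `H`, between the functionals `L (H f)` and
  -- `f`; their pairing is `⟨L H f, H f⟩`.
  have h1 := hH.apply_sq_le (L (H f)) f
  have h2 := h (L (H f))
  rw [opInv_apply_self hb] at h2
  have h3 := hH.apply_nonneg f
  have h4 := hp (H f)
  have h5 : L (H f) (H f) ≤ c⁻¹ * f (H f) := by
    refine le_mul_of_sq_le (by positivity) h4 h3 (h1.trans (mul_le_mul_of_nonneg_right ?_ h3))
    rwa [inv_mul_eq_div, le_div_iff₀ hc, mul_comm]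
  rwa [inv_mul_eq_div, le_div_iff₀ hc, mul_comm] at h5

/-- The bound `A ≤ β D` gives `D⁻¹ ≤ β A⁻¹`. -/
lemma apply_opInv_le {β : ℝ} (hβ : 0 ≤ β) {A D : V →ₗ[ℝ] Dual ℝ V}
    (hs : ∀ u v, A u v = A v u) (hp : ∀ v, 0 ≤ A v v) (hp' : ∀ v, 0 ≤ D v v)
    (hA : Function.Bijective A) (hD : Function.Bijective D)
    (h : ∀ v, A v v ≤ β * D v v) (f : Dual ℝ V) : f (opInv D f) ≤ β * f (opInv A f) := by
  have h1 := apply_sq_le hs hp (opInv A f) (opInv D f)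
  have h2 := h (opInv D f)
  have h3 := hp (opInv A f)
  have h4 := hp' (opInv D f)
  rw [apply_opInv hD] at h2 h4
  rw [apply_opInv hA] at h1 h3
  refine le_mul_of_sq_le hβ h4 h3 (h1.trans ?_)
  calc _ ≤ _ := mul_le_mul_of_nonneg_left h2 h3
    _ = _ := by ring

/-- The triangular operator `(v, u) ↦ (H⁻¹ v + C u, H'⁻¹ u)` is bijective. -/
lemma upperTriangular_bijective {V' U U' : Type*} [AddCommGroup V'] [Module ℝ V']
    [AddCommGroup U] [Module ℝ U] [AddCommGroup U'] [Module ℝ U'] {H : V' →ₗ[ℝ] V}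
    {H' : U' →ₗ[ℝ] U} (hH : Function.Bijective H) (hH' : Function.Bijective H')
    (C : U →ₗ[ℝ] V') {R : V × U → V' × U'}
    (hR : ∀ v u, R (v, u) = (opInv H v + C u, opInv H' u)) : Function.Bijective R := by
  have hi : ∀ v, H (opInv H v) = v := apply_opInv hH
  have hi' : ∀ v, H' (opInv H' v) = v := apply_opInv hH'
  constructor
  · rintro ⟨v, u⟩ ⟨v', u'⟩ h
    rw [hR, hR, Prod.mk.injEq] at h
    obtain ⟨h1, h2⟩ := h
    have hu : u = u' := by rw [← hi' u, ← hi' u', h2]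
    subst hu
    have hv : v = v' := by rw [← hi v, ← hi v', add_right_cancel h1]
    rw [hv]
  · rintro ⟨f, e⟩
    refine ⟨(H (f - C (H' e)), H' e), ?_⟩
    rw [hR, opInv_apply_self hH, opInv_apply_self hH', sub_add_cancel]

end Abstract

/-! ## Inexact block triangular preconditioning of a saddle point operator -/

section Saddle

variable {V U : Type*} [AddCommGroup V] [Module ℝ V] [AddCommGroup U] [Module ℝ U]
  {A D : V →ₗ[ℝ] Dual ℝ V} {B : V →ₗ[ℝ] Dual ℝ U}
  {Hw : Dual ℝ V →ₗ[ℝ] V} {Hp : Dual ℝ U →ₗ[ℝ] U}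
  {β c₁w c₂w c₁p c₂p ρ : ℝ}

/-- If `‖I - H A‖_A ≤ 1` then `A ≤ 2 H⁻¹`. -/
lemma apply_le_two_mul_of_contraction (hρ₁ : ρ ≤ 1)
    (hs : ∀ u v, A u v = A v u) (hp : ∀ v, 0 ≤ A v v) (hb : Function.Bijective A)
    (h : ∀ w, opNorm A (w - Hw (A w)) ≤ ρ * opNorm A w) (g : Dual ℝ V) :
    A (Hw g) (Hw g) ≤ 2 * g (Hw g) := by
  obtain ⟨y, rfl⟩ := hb.2 g
  have h1 : opNorm A (y - Hw (A y)) ≤ opNorm A y :=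
    (h y).trans (mul_le_of_le_one_left (Real.sqrt_nonneg _) hρ₁)
  have h2 := (Real.sqrt_le_sqrt_iff (hp y)).1 h1
  have h3 := hs y (Hw (A y))
  simp only [map_sub, LinearMap.sub_apply] at h2
  linarith

/-- The bound `⟨B w, S⁻¹ B w⟩ ≤ ⟨D w, w⟩` for the Schur complement `S = B D⁻¹ Bᵀ`. -/
lemma schur_apply_le (hs : ∀ u v, D u v = D v u) (hp : ∀ v, 0 ≤ D v v)
    (hD : Function.Bijective D) (hS : Function.Bijective (B ∘ₗ opInv D ∘ₗ B.flip)) (w : V) :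
    B w (opInv (B ∘ₗ opInv D ∘ₗ B.flip) (B w)) ≤ D w w := by
  -- The vector `v = D⁻¹ Bᵀ q` satisfies `B v = B w` and is the `D`-orthogonal projection of `w`:
  -- both `⟨D v, w⟩` and `⟨D v, v⟩` equal `⟨B w, q⟩`. A projection does not increase the energy.
  set q := opInv (B ∘ₗ opInv D ∘ₗ B.flip) (B w) with hq
  have h1 : B (opInv D (B.flip q)) = B w := apply_opInv hS (B w)
  have h2 : D (opInv D (B.flip q)) = B.flip q := apply_opInv hD _
  have h3 := apply_sq_le hs hp (opInv D (B.flip q)) w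
  have h4 := hp (opInv D (B.flip q))
  rw [h2, LinearMap.flip_apply, LinearMap.flip_apply, h1] at h3
  rw [h2, LinearMap.flip_apply, h1] at h4
  have := le_mul_of_sq_le zero_le_one h4 (hp w) (by linarith)
  linarith

/-- Field-of-values bounds for the saddle point operator, preconditioned by the inexact block
upper triangular preconditioner, at `x' = (H_w⁻¹ w + Bᵀ p, H_p⁻¹ p)` with `w = H_w f` and
`p = H_p e`. -/
theorem saddle_fieldOfValues (hβ : 0 < β)
    (hc₁w : 0 < c₁w) (hc₂w : 0 < c₂w) (hc₁p : 0 < c₁p) (hc₂p : 0 < c₂p)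
    (hρ₁ : ρ ≤ 1)
    (hAs : ∀ u v, A u v = A v u) (hDs : ∀ u v, D u v = D v u)
    (hAp : ∀ v, 0 ≤ A v v) (hDp : ∀ v, 0 ≤ D v v) (hDb : Function.Bijective D)
    (hAD : ∀ v, A v v ≤ β * D v v) (hDA : ∀ v, D v v ≤ β * A v v)
    (hHw : IsSPD Hw) (hHp : IsSPD Hp)
    (hw : SpectrallyEquiv c₁w c₂w Hw A)
    (hp : SpectrallyEquiv c₁p c₂p Hp (B ∘ₗ opInv D ∘ₗ B.flip))
    (hc : ∀ w, opNorm A (w - Hw (A w)) ≤ ρ * opNorm A w)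
    (f : Dual ℝ V) (e : Dual ℝ U) :
    (f + B.flip (Hp e)) (Hw (f + B.flip (Hp e))) + e (Hp e) ≤
      5 * (2 * c₂w + 2 + c₂p * β * c₂w) *
        ((A (Hw f) + B.flip (Hp e)) (Hw (f + B.flip (Hp e))) + (-(B (Hw f))) (Hp e)) ∧
    (A (Hw f) + B.flip (Hp e)) (Hw (A (Hw f) + B.flip (Hp e))) +
        (-(B (Hw f))) (Hp (-(B (Hw f)))) ≤
      ((2 / c₁w + β / c₁p) * (2 / c₁w) * (1 + β / (c₁w * c₁p)) + 2 * (β / (c₁w * c₁p))) *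
        ((f + B.flip (Hp e)) (Hw (f + B.flip (Hp e))) + e (Hp e)) := by
  have hAb := hw.bijective hc₁w hHw
  have hSb := hp.bijective hc₁p hHp
  have hSapp : ∀ p q, (B ∘ₗ opInv D ∘ₗ B.flip) p q = (B.flip q) (opInv D (B.flip p)) :=
    fun p q => rfl
  have hSs : ∀ p q, (B ∘ₗ opInv D ∘ₗ B.flip) p q = (B ∘ₗ opInv D ∘ₗ B.flip) q p := fun p q => by
    rw [hSapp, hSapp]
    conv_lhs => rw [← apply_opInv hDb (B.flip q)]
    conv_rhs => rw [← apply_opInv hDb (B.flip p)]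
    rw [hDs]
  have hSp : ∀ p, 0 ≤ (B ∘ₗ opInv D ∘ₗ B.flip) p p := fun p => by
    rw [hSapp]
    have := hDp (opInv D (B.flip p))
    rwa [apply_opInv hDb] at this
  set w := Hw f with hwdef
  set g := B.flip (Hp e) with hgdef
  have hgw : B w (Hp e) = g w := rfl
  -- the norms of the two blocks
  have a0 := hAp w
  have h0 := hHw.apply_nonneg g
  have e0 := hHp.apply_nonneg e
  have f1 : f w ≤ c₂w * A w w :=
    apply_le_of_opInv_le hc₂w.le hHw hAs hAp hAb (fun f => (hw f).2) f
  have f2 : c₁w * A w w ≤ f w :=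
    mul_apply_le_of_le_opInv hc₁w hHw hAp hAb (fun f => (hw f).1) f
  have e1 : e (Hp e) ≤ c₂p * g (opInv D g) :=
    apply_le_of_opInv_le hc₂p.le hHp hSs hSp hSb (fun f => (hp f).2) e
  have e2 : c₁p * g (opInv D g) ≤ e (Hp e) :=
    mul_apply_le_of_le_opInv hc₁p hHp hSp hSb (fun f => (hp f).1) e
  have d1 : g (opInv D g) ≤ β * g (opInv A g) := apply_opInv_le hβ.le hAs hAp hDp hAb hDb hAD g
  have d2 : g (opInv A g) ≤ β * g (opInv D g) := apply_opInv_le hβ.le hDs hDp hAp hDb hAb hDA g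
  obtain ⟨g1, g2⟩ := hw g
  have z1 : A (Hw g) (Hw g) ≤ 2 * g (Hw g) :=
    apply_le_two_mul_of_contraction hρ₁ hAs hAp hAb hc g
  have s1 := hHw.add_apply_le f g
  constructor
  · have hx : A w w + A w (Hw g) + g (Hw g) ≥ 1 / 5 * (A w w + g (Hw g)) := by
      -- With `z1`, the weights 5 and 4 bound the cross term below by `-(5/8) ⟨A w, w⟩ - (4/5) ⟨g,
      -- Hw g⟩`, leaving the coefficients 3/8 and 1/5.
      have h1 := hAp ((5 : ℝ) • w + (4 : ℝ) • Hw g)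
      have h2 := hAs w (Hw g)
      simp only [map_add, map_smul, LinearMap.add_apply, LinearMap.smul_apply, smul_eq_mul] at h1
      linarith
    have hN : (f + g) (Hw (f + g)) + e (Hp e) ≤
        (2 * c₂w + 2 + c₂p * β * c₂w) * (A w w + g (Hw g)) := by
      have h1 : e (Hp e) ≤ c₂p * β * c₂w * g (Hw g) := by
        calc _ ≤ c₂p * (β * (c₂w * g (Hw g))) := e1.trans (by gcongr; exact d1.trans (by gcongr))
          _ = _ := by ring
      have h2 : 0 ≤ c₂p * β * c₂w * A w w := by positivity
      have h3 : 0 ≤ c₂w * g (Hw g) := by positivity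
      nlinarith
    -- The pairing `g w` from the flux row cancels against `-B w` tested with `p`; this is where the
    -- skew sign of the lower block is used.
    have hF : (A w + g) (Hw (f + g)) + (-(B w)) (Hp e) = A w w + A w (Hw g) + g (Hw g) := by
      simp only [map_add, LinearMap.add_apply, LinearMap.neg_apply, ← hwdef, hgw]
      ring
    rw [hF]
    refine hN.trans ?_
    have hC : 0 ≤ 2 * c₂w + 2 + c₂p * β * c₂w := by positivity
    nlinarith [mul_le_mul_of_nonneg_left hx.le hC]
  · have s2 := hHw.add_apply_le (A w) g
    have t1 : c₁w * A w (Hw (A w)) ≤ A w w := by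
      have := (hw (A w)).1
      rwa [opInv_apply_self hAb] at this
    have t2 : c₁p * B w (Hp (B w)) ≤ β * A w w :=
      ((hp (B w)).1.trans (schur_apply_le hDs hDp hDb hSb w)).trans (hDA w)
    -- Split `f = (f + g) - g`: only `f + g` is a component of `x'`, and `g` is controlled by the
    -- other component `e` through `u4`.
    have s3 : f w ≤ 2 * (f + g) (Hw (f + g)) + 2 * g (Hw g) := by
      have := hHw.add_apply_le (f + g) (-g)
      rw [add_neg_cancel_right] at this
      simpa only [map_neg, LinearMap.neg_apply, neg_neg] using this
    have u1 : A w (Hw (A w)) ≤ A w w / c₁w := by rwa [le_div_iff₀ hc₁w, mul_comm]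
    have u2 : B w (Hp (B w)) ≤ β * A w w / c₁p := by rwa [le_div_iff₀ hc₁p, mul_comm]
    have u3 : A w w ≤ f w / c₁w := by rwa [le_div_iff₀ hc₁w, mul_comm]
    have u4 : g (Hw g) ≤ β / (c₁w * c₁p) * e (Hp e) := by
      rw [div_mul_eq_mul_div, le_div_iff₀ (by positivity)]
      calc _ = c₁p * (c₁w * g (Hw g)) := by ring
        _ ≤ c₁p * (β * g (opInv D g)) := mul_le_mul_of_nonneg_left (g1.trans d2) hc₁p.le
        _ = β * (c₁p * g (opInv D g)) := by ring
        _ ≤ _ := by gcongr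
    have n0 := hHw.apply_nonneg (f + g)
    set N := (f + g) (Hw (f + g)) with hN
    have u5 : A w w ≤ 2 / c₁w * (1 + β / (c₁w * c₁p)) * (N + e (Hp e)) := by
      calc _ ≤ (2 * N + 2 * (β / (c₁w * c₁p) * e (Hp e))) / c₁w :=
            u3.trans (by gcongr; linarith)
        _ = 2 / c₁w * (1 * N + β / (c₁w * c₁p) * e (Hp e)) := by ring
        _ ≤ 2 / c₁w * ((1 + β / (c₁w * c₁p)) * N + (1 + β / (c₁w * c₁p)) * e (Hp e)) := by
            have : 0 ≤ β / (c₁w * c₁p) := by positivity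
            gcongr <;> linarith
        _ = _ := by ring
    have u6 : g (Hw g) ≤ β / (c₁w * c₁p) * (N + e (Hp e)) := u4.trans (by gcongr; linarith)
    simp only [map_neg, LinearMap.neg_apply, neg_neg]
    calc _ ≤ (2 / c₁w + β / c₁p) * A w w + 2 * g (Hw g) := by
          have : (2 / c₁w + β / c₁p) * A w w = 2 * (A w w / c₁w) + β * A w w / c₁p := by ring
          linarith
      _ ≤ (2 / c₁w + β / c₁p) * (2 / c₁w * (1 + β / (c₁w * c₁p)) * (N + e (Hp e))) +
          2 * (β / (c₁w * c₁p) * (N + e (Hp e))) := by gcongr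
      _ = _ := by ring

/-- The field-of-values bounds in the inner product of the block diagonal preconditioner. -/
theorem saddle_precond_bounds [FiniteDimensional ℝ V] [FiniteDimensional ℝ U]
    {C : U →ₗ[ℝ] Dual ℝ V} {R S : V × U →ₗ[ℝ] Dual ℝ V × Dual ℝ U}
    {M N : Dual ℝ V × Dual ℝ U →ₗ[ℝ] V × U} {L : U →ₗ[ℝ] Dual ℝ U}
    (hC : B.flip = C) (hR : ∀ v u, R (v, u) = (opInv Hw v + C u, opInv Hp u))
    (hS : ∀ v u, S (v, u) = (A v + C u, -(B v))) (hM : ∀ f e, M (f, e) = (Hw f, Hp e))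
    (hN : N = opInv R) (hL : L = B ∘ₗ opInv D ∘ₗ C) (hβ : 0 < β)
    (hc₁w : 0 < c₁w) (hc₂w : 0 < c₂w) (hc₁p : 0 < c₁p) (hc₂p : 0 < c₂p) (hρ₁ : ρ ≤ 1)
    (hAs : ∀ u v, A u v = A v u) (hDs : ∀ u v, D u v = D v u)
    (hAp : ∀ v, 0 ≤ A v v) (hDp : ∀ v, 0 ≤ D v v)
    (hAD : ∀ v, A v v ≤ β * D v v) (hDA : ∀ v, D v v ≤ β * A v v)
    (hHw : IsSPD Hw) (hHp : IsSPD Hp)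
    (hw : SpectrallyEquiv c₁w c₂w Hw A)
    (hp : SpectrallyEquiv c₁p c₂p Hp L)
    (hc : ∀ w, opNorm A (w - Hw (A w)) ≤ ρ * opNorm A w) :
    Function.Bijective R ∧ ∀ (x : V × U) (x' : Dual ℝ V × Dual ℝ U), x ≠ 0 → x' = R x →
      (5 * (2 * c₂w + 2 + c₂p * β * c₂w))⁻¹ ≤
        dualInner M (S (N x')) x' / dualInner M x' x' ∧
      dualNorm M (S (N x')) / dualNorm M x' ≤
        √((2 / c₁w + β / c₁p) * (2 / c₁w) * (1 + β / (c₁w * c₁p)) + 2 * (β / (c₁w * c₁p))) := by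
  subst hL hC hN
  -- Definiteness of `D` is inherited from `A` through `A ≤ β D`.
  have hDb : Function.Bijective D := bijective_of_pos fun w h0 =>
    pos_of_mul_pos_right ((hw.pos hc₁w hHw h0).trans_le (hAD w)) hβ.le
  have hHwb := hHw.bijective
  have hHpb := hHp.bijective
  have hub : Function.Bijective R := upperTriangular_bijective hHwb hHpb B.flip hR
  have hI : ∀ x y, dualInner M x y = x.1 (Hw y.1) + x.2 (Hp y.2) := fun x y => by
    rw [dualInner, hM]
  refine ⟨hub, ?_⟩
  rintro x x' hx rfl
  have hpos : 0 < dualInner M (R x) (R x) := by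
    have h0 : R x ≠ 0 := fun h => hx (hub.1 (by rw [h, map_zero]))
    have h1 := hHw.apply_nonneg (R x).1
    have h2 := hHp.apply_nonneg (R x).2
    rw [hI]
    by_cases h3 : (R x).1 = 0
    · have := hHp.2 _ fun h4 => h0 (Prod.ext h3 h4)
      linarith
    · have := hHw.2 _ h3
      linarith
  rw [opInv_apply_self hub]
  obtain ⟨w, p⟩ := x
  -- Writing the unknowns as `Hw f` and `Hp e` turns the inverses in the triangular operator into
  -- `f` and `e`.
  obtain ⟨f, rfl⟩ := hHwb.2 w
  obtain ⟨e, rfl⟩ := hHpb.2 p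
  rw [hR, opInv_apply_self hHwb, opInv_apply_self hHpb] at hpos ⊢
  rw [hS]
  obtain ⟨k1, k2⟩ := saddle_fieldOfValues hβ hc₁w hc₂w hc₁p hc₂p hρ₁ hAs hDs hAp hDp hDb hAD hDA
    hHw hHp hw hp hc f e
  constructor
  · rw [le_div_iff₀ hpos, inv_mul_le_iff₀ (by positivity)]
    rw [hI, hI]
    exact k1
  · rw [dualNorm, dualNorm, div_le_iff₀ (Real.sqrt_pos.2 hpos), ← Real.sqrt_mul (by positivity), hI, hI]
    exact Real.sqrt_le_sqrt k2

end Saddle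


/-! ## Lowest-order Raviart--Thomas fields on a simplex -/

section Local

variable {d : ℕ} (T : Cell (d + 1))

lemma Cell.norm_normal (f : Fin (d + 2)) : ‖T.normal f‖ = 1 := by
  have h := T.height_pos f
  rw [Cell.normal, norm_smul, norm_inv, Real.norm_of_nonneg h.le, ← dist_eq_norm, dist_comm]
  exact inv_mul_cancel₀ h.ne'

lemma Cell.inner_sub_normal {f g : Fin (d + 2)} (h : g ≠ f) :
    inner ℝ (T.points g - T.points f) (T.normal f) = T.height f := by
  have h1 := T.inner_vsub_vsub_altitudeFoot_eq_height_sq h.symm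
  have h2 := T.height_pos f
  rw [vsub_eq_sub, vsub_eq_sub] at h1
  rw [Cell.normal, real_inner_smul_right, ← neg_sub (T.points f), ← neg_sub (T.points f),
    inner_neg_neg, h1]
  field_simp

/-- The centroid averages the `d + 1` vertices other than `f`, and each of them lies at distance
`height` from vertex `f` in the normal direction. -/
lemma Cell.inner_centroid_sub_normal (f : Fin (d + 2)) :
    inner ℝ (T.faceOppositeCentroid f - T.points f) (T.normal f) = T.height f := by
  have h := T.faceOppositeCentroid_vsub_point_eq_smul_sum_vsub f
  simp only [vsub_eq_sub] at h
  rw [h, real_inner_smul_left, sum_inner, ← Finset.add_sum_erase _ _ (Finset.mem_univ f),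
    Finset.sum_congr rfl fun g hg => T.inner_sub_normal (Finset.ne_of_mem_erase hg)]
  have : ((d + 1 : ℕ) : ℝ) ≠ 0 := by positivity
  simp [Finset.card_erase_of_mem]
  field_simp

lemma Cell.normalComp_basisField (f g : Fin (d + 2)) :
    T.normalComp g (T.basisField f) = if g = f then 1 else 0 := by
  have h := T.height_pos f
  change inner ℝ ((T.height f)⁻¹ • (T.faceOppositeCentroid g - T.points f)) (T.normal g) = _
  rw [real_inner_smul_left]
  split_ifs with hgf
  · subst hgf
    rw [T.inner_centroid_sub_normal, inv_mul_cancel₀ h.ne']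
  -- For `g ≠ f`, both the centroid of facet `g` and the vertex `f` lie in the plane of facet `g`,
  -- at the same height over vertex `g`.
  · rw [← sub_sub_sub_cancel_right _ _ (T.points g), inner_sub_left,
      T.inner_centroid_sub_normal, T.inner_sub_normal (Ne.symm hgf), sub_self, mul_zero]

/-- The parametrization `(m, s) ↦ (x ↦ m + s x)` of the local Raviart--Thomas space. -/
def RT0.ofCoeffs (d : ℕ) : Vec d × ℝ →ₗ[ℝ] RT0 d where
  toFun c := ⟨fun x => c.1 + c.2 • x, c.1, c.2, fun _ => rfl⟩
  map_add' c c' := by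
    ext1; funext x
    simp only [Prod.fst_add, Prod.snd_add, add_smul, Submodule.coe_add, Pi.add_apply]
    abel
  map_smul' a c := by
    ext1; funext x
    simp [mul_smul]

lemma RT0.ofCoeffs_surjective (d : ℕ) : Function.Surjective (RT0.ofCoeffs d) := by
  rintro ⟨v, m, s, hv⟩
  exact ⟨(m, s), Subtype.ext (funext fun x => (hv x).symm)⟩

instance (d : ℕ) : FiniteDimensional ℝ (RT0 d) :=
  Module.Finite.of_surjective _ (RT0.ofCoeffs_surjective d)

/-- The `d + 2` normal components can be prescribed freely by the basis fields, and the space has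
dimension at most `d + 2`. Hence they determine a field, and both sides have the same ones. -/
lemma Cell.sum_normalComp_smul_basisField (v : RT0 (d + 1)) :
    ∑ f, T.normalComp f v • T.basisField f = v := by
  have happ (c : Fin (d + 2) → ℝ) (g : Fin (d + 2)) :
      T.normalComp g (∑ f, c f • T.basisField f) = c g := by
    simp [Cell.normalComp_basisField]
  let Φ : RT0 (d + 1) →ₗ[ℝ] (Fin (d + 2) → ℝ) := LinearMap.pi T.normalComp
  have hs : Function.Surjective Φ := fun c => ⟨∑ f, c f • T.basisField f, funext (happ c)⟩
  have h1 : finrank ℝ (RT0 (d + 1)) ≤ d + 2 := by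
    have := LinearMap.finrank_le_finrank_of_surjective (RT0.ofCoeffs_surjective (d + 1))
    simpa using this
  have h2 := LinearMap.finrank_le_finrank_of_surjective hs
  have hi : Function.Injective Φ := by
    refine (LinearMap.injective_iff_surjective_of_finrank_eq_finrank ?_).2 hs
    refine le_antisymm ?_ h2
    simpa using h1
  exact hi (funext fun g => happ _ g)

/-- The slab between the facet plane and its parallel through the opposite vertex is convex and
contains all vertices. -/
lemma Cell.inner_sub_point_mem_Icc (f : Fin (d + 2)) {x : Vec (d + 1)} (hx : x ∈ T.set) :
    inner ℝ (x - T.points f) (T.normal f) ∈ Set.Icc 0 (T.height f) := by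
  have h0 := (T.height_pos f).le
  let L : Vec (d + 1) →ₗ[ℝ] ℝ := (innerₗ (Vec (d + 1))).flip (T.normal f)
  have hL : ∀ y, L y = inner ℝ y (T.normal f) := fun y => rfl
  have hc : Convex ℝ (L ⁻¹' Set.Icc (L (T.points f)) (L (T.points f) + T.height f)) :=
    (convex_Icc _ _).linear_preimage L
  have hm : x ∈ L ⁻¹' Set.Icc (L (T.points f)) (L (T.points f) + T.height f) := by
    refine convexHull_min ?_ hc hx
    rintro _ ⟨g, rfl⟩
    rcases eq_or_ne g f with rfl | hg
    · simpa using h0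
    · have := T.inner_sub_normal hg
      rw [inner_sub_left, ← hL, ← hL] at this
      constructor <;> linarith
  rw [inner_sub_left, ← hL, ← hL]
  constructor <;> linarith [hm.1, hm.2]

/-- The radius of a ball inside a simplex is bounded by the heights. -/
lemma Cell.radius_le_height {c : Vec (d + 1)} {r : ℝ} (hr : 0 < r)
    (h : Metric.closedBall c r ⊆ T.set) (f : Fin (d + 2)) : r ≤ T.height f := by
  have hp := T.inner_sub_point_mem_Icc f (h (Metric.mem_closedBall_self hr.le))
  -- The centre and this boundary point of the ball lie in the same slab, and their normal
  -- coordinates differ by `r`.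
  have hq : c + r • T.normal f ∈ T.set := h (by simp [norm_smul, T.norm_normal, abs_of_pos hr])
  have hq' := T.inner_sub_point_mem_Icc f hq
  rw [add_sub_right_comm, inner_add_left, real_inner_smul_left, real_inner_self_eq_norm_sq,
    T.norm_normal] at hq'
  linarith [hp.1, hq'.2]

lemma Cell.faceOppositeCentroid_mem (f : Fin (d + 2)) : T.faceOppositeCentroid f ∈ T.set := by
  have h := T.faceOppositeCentroid_eq_affineCombination f
  have hw : ∑ g ∈ ({f}ᶜ : Finset (Fin (d + 2))), ((d + 1 : ℕ) : ℝ)⁻¹ = 1 := by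
    have : ((d + 1 : ℕ) : ℝ) ≠ 0 := by positivity
    simp [Finset.card_compl]
    field_simp
  rw [h]
  exact convexHull_mono (Set.range_subset_iff.2 fun g => Set.mem_range_self g)
    (affineCombination_mem_convexHull (fun g _ => by positivity) hw)

lemma Cell.dist_le_diam {x y : Vec (d + 1)} (hx : x ∈ T.set) (hy : y ∈ T.set) :
    ‖x - y‖ ≤ Metric.diam T.set := by
  rw [← dist_eq_norm]
  exact Metric.dist_le_diam_of_mem T.isCompact_set.isBounded hx hy

/-! ## Bounds for the inverse permeability -/

variable {K : Matrix (Fin (d + 1)) (Fin (d + 1)) ℝ}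

lemma toEuclideanLin_inv_apply (hK : K.PosDef) (x : Vec (d + 1)) :
    Matrix.toEuclideanLin K (Matrix.toEuclideanLin K⁻¹ x) = x := by
  have hu : IsUnit K.det := hK.det_pos.ne'.isUnit
  simp [Matrix.toLpLin_apply, Matrix.mulVec_mulVec, Matrix.mul_nonsing_inv _ hu]

lemma inner_toEuclideanLin_symm (hK : K.IsHermitian) (x y : Vec (d + 1)) :
    inner ℝ (Matrix.toEuclideanLin K x) y = inner ℝ (Matrix.toEuclideanLin K y) x := by
  rw [(Matrix.isSymmetric_toEuclideanLin_iff.2 hK) x y, real_inner_comm]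

lemma inner_inv_le (hK : K.PosDef) {m : ℝ} (hm : 0 < m)
    (h : ∀ x : Vec (d + 1), m * ‖x‖ ^ 2 ≤ inner ℝ (Matrix.toEuclideanLin K x) x)
    (x : Vec (d + 1)) : inner ℝ (Matrix.toEuclideanLin K⁻¹ x) x ≤ m⁻¹ * ‖x‖ ^ 2 := by
  set w := Matrix.toEuclideanLin K⁻¹ x with hw
  have h1 := h w
  rw [hw, toEuclideanLin_inv_apply hK, ← hw, real_inner_comm] at h1
  have h2 := real_inner_le_norm w x
  rw [inv_mul_eq_div, le_div_iff₀ hm]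
  have h3 : m * ‖w‖ ≤ ‖x‖ := by
    rcases (norm_nonneg w).eq_or_lt with h0 | h0
    · rw [← h0]; simp
    · exact le_of_mul_le_mul_right (by nlinarith) h0
  nlinarith [norm_nonneg x, mul_le_mul_of_nonneg_right h3 (norm_nonneg x)]

lemma le_inner_inv (hK : K.PosDef) {M : ℝ} (hM : 0 < M)
    (hp : ∀ x : Vec (d + 1), 0 ≤ inner ℝ (Matrix.toEuclideanLin K x) x)
    (h : ∀ x : Vec (d + 1), inner ℝ (Matrix.toEuclideanLin K x) x ≤ M * ‖x‖ ^ 2)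
    (x : Vec (d + 1)) : M⁻¹ * ‖x‖ ^ 2 ≤ inner ℝ (Matrix.toEuclideanLin K⁻¹ x) x := by
  set w := Matrix.toEuclideanLin K⁻¹ x with hw
  have hx : Matrix.toEuclideanLin K w = x := toEuclideanLin_inv_apply hK x
  have hx' : inner ℝ (Matrix.toEuclideanLin K x) w = ‖x‖ ^ 2 := by
    rw [inner_toEuclideanLin_symm hK.1, hx, real_inner_self_eq_norm_sq]
  -- Completing the square: expanding `K` at `K⁻¹ x - M⁻¹ x` gives `⟨x, K⁻¹ x⟩ ≥ 2 M⁻¹ ‖x‖² - M⁻² ⟨K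
  -- x, x⟩`.
  have h1 := hp (w - M⁻¹ • x)
  have h2 := h x
  rw [map_sub, map_smul, hx, inner_sub_left, inner_sub_right, inner_sub_right,
    real_inner_smul_left, real_inner_smul_left, real_inner_smul_right, real_inner_smul_right,
    real_inner_self_eq_norm_sq, hx', real_inner_comm] at h1
  have h3 : M⁻¹ * (M⁻¹ * inner ℝ (Matrix.toEuclideanLin K x) x) ≤ M⁻¹ * ‖x‖ ^ 2 := by
    have : M⁻¹ * (M * ‖x‖ ^ 2) = ‖x‖ ^ 2 := by field_simp
    gcongr
    rw [← this]
    gcongr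
  linarith

/-! ## The element forms -/

lemma Cell.fluxForm_symm (hK : K.PosDef) (u v : RT0 (d + 1)) :
    T.fluxForm K u v = T.fluxForm K v u := by
  change ∫ x in T.set, _ = ∫ x in T.set, _
  congr 1
  funext x
  exact inner_toEuclideanLin_symm hK.1.inv _ _

lemma Cell.fluxForm_nonneg (hK : K.PosDef)
    (hp : ∀ x : Vec (d + 1), 0 ≤ inner ℝ (Matrix.toEuclideanLin K x) x) (v : RT0 (d + 1)) :
    0 ≤ T.fluxForm K v v := by
  refine integral_nonneg fun x => ?_
  have := hp (Matrix.toEuclideanLin K⁻¹ ((v : Vec (d + 1) → Vec (d + 1)) x))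
  rwa [toEuclideanLin_inv_apply hK, real_inner_comm] at this

lemma Cell.diagFluxForm_apply (u v : RT0 (d + 1)) :
    T.diagFluxForm K u v = ∑ f, T.normalComp f u * T.normalComp f v *
      T.fluxForm K (T.basisField f) (T.basisField f) := rfl

lemma Cell.diagFluxForm_symm (u v : RT0 (d + 1)) :
    T.diagFluxForm K u v = T.diagFluxForm K v u := by
  simp only [Cell.diagFluxForm_apply, mul_comm (T.normalComp _ u)]

lemma Cell.diagFluxForm_nonneg (hK : K.PosDef)
    (hp : ∀ x : Vec (d + 1), 0 ≤ inner ℝ (Matrix.toEuclideanLin K x) x) (v : RT0 (d + 1)) :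
    0 ≤ T.diagFluxForm K v v := by
  rw [Cell.diagFluxForm_apply]
  exact Finset.sum_nonneg fun _ _ => mul_nonneg (mul_self_nonneg _) (T.fluxForm_nonneg hK hp _)

/-- A symmetric positive semidefinite form is bounded by the number of summands times its
diagonal. -/
lemma apply_sum_le_card_mul {V ι : Type*} [AddCommGroup V] [Module ℝ V] [Fintype ι]
    {L : V →ₗ[ℝ] V →ₗ[ℝ] ℝ} (hs : ∀ u v, L u v = L v u) (hp : ∀ v, 0 ≤ L v v) (x : ι → V) :
    L (∑ i, x i) (∑ i, x i) ≤ Fintype.card ι * ∑ i, L (x i) (x i) := by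
  have h : ∀ i j, L (x i) (x j) ≤ (L (x i) (x i) + L (x j) (x j)) / 2 := fun i j => by
    have h1 := hp (x i - x j)
    have h2 := hs (x i) (x j)
    simp only [map_sub, LinearMap.sub_apply] at h1
    linarith
  calc L (∑ i, x i) (∑ i, x i) = ∑ i, ∑ j, L (x i) (x j) := by
        simp only [map_sum, LinearMap.sum_apply]
        exact Finset.sum_comm
    _ ≤ ∑ i, ∑ j, (L (x i) (x i) + L (x j) (x j)) / 2 := by gcongr; exact h _ _
    _ = Fintype.card ι * ∑ i, L (x i) (x i) := by
        simp only [← Finset.sum_div, Finset.sum_add_distrib, Finset.sum_const, Finset.card_univ,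
          nsmul_eq_mul, ← Finset.mul_sum]
        ring

lemma Cell.fluxForm_le_diagFluxForm (hK : K.PosDef)
    (hp : ∀ x : Vec (d + 1), 0 ≤ inner ℝ (Matrix.toEuclideanLin K x) x) (v : RT0 (d + 1)) :
    T.fluxForm K v v ≤ (d + 2) * T.diagFluxForm K v v := by
  have h := apply_sum_le_card_mul (T.fluxForm_symm hK) (T.fluxForm_nonneg hK hp)
    fun f => T.normalComp f v • T.basisField f
  rw [T.sum_normalComp_smul_basisField] at h
  simp only [map_smul, LinearMap.smul_apply, smul_eq_mul, Fintype.card_fin, ← mul_assoc] at h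
  rw [Cell.diagFluxForm_apply]
  exact_mod_cast h

/-! ### Raviart–Thomas fields on shape regular cells. -/

lemma volume_real_closedBall_le (c c' : Vec (d + 1)) {R r t : ℝ} (hr : 0 < r) (ht : 0 ≤ t)
    (h : R ≤ t * r) :
    volume.real (Metric.closedBall c R) ≤ t ^ (d + 1) * volume.real (Metric.closedBall c' r) := by
  calc _ ≤ volume.real (Metric.closedBall c (t * r)) :=
        measureReal_mono (Metric.closedBall_subset_closedBall h) measure_closedBall_lt_top.ne
    _ = _ := by
        rw [Measure.addHaar_real_closedBall _ _ (by positivity),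
          Measure.addHaar_real_closedBall _ c' hr.le, mul_pow, mul_assoc]
        simp

/-- A field `x ↦ m + s x` on a ball is large on a ball of a quarter of the radius. -/
lemma exists_closedBall_le_norm (v : RT0 (d + 1)) :
    ∃ s : ℝ, ∀ c : Vec (d + 1), ∀ r : ℝ, 0 < r →
      (∀ x, ‖(v : Vec (d + 1) → Vec (d + 1)) x‖ ≤
        ‖(v : Vec (d + 1) → Vec (d + 1)) c‖ + |s| * ‖x - c‖) ∧
      ∃ c', Metric.closedBall c' (r / 4) ⊆ Metric.closedBall c r ∧
        ∀ x ∈ Metric.closedBall c' (r / 4),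
          ‖(v : Vec (d + 1) → Vec (d + 1)) c‖ + |s| * (r / 2) ≤
            ‖(v : Vec (d + 1) → Vec (d + 1)) x‖ := by
  obtain ⟨v, m, s, hv⟩ := v
  refine ⟨s, fun c r hr => ⟨fun x => ?_, ?_⟩⟩
  · have : v x = v c + s • (x - c) := by rw [hv, hv, smul_sub]; abel
    change ‖v x‖ ≤ ‖v c‖ + _
    rw [this, ← Real.norm_eq_abs, ← norm_smul]
    exact norm_add_le _ _
  · change ∃ c', _ ∧ ∀ x ∈ _, ‖v c‖ + _ ≤ ‖v x‖
    -- Moving from `c` along `τ e`, with `e` the direction of `v c` and `τ` a sign of `s`, makes the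
    -- linear part add to `v c` without cancellation. If `v c = 0`, any unit vector serves.
    obtain ⟨e, he, hve⟩ : ∃ e : Vec (d + 1), ‖e‖ = 1 ∧ v c = ‖v c‖ • e := by
      by_cases h0 : v c = 0
      · exact ⟨EuclideanSpace.single 0 1, by simp, by simp [h0]⟩
      · exact ⟨‖v c‖⁻¹ • v c, norm_smul_inv_norm h0,
          by rw [smul_smul, mul_inv_cancel₀ (norm_ne_zero_iff.2 h0), one_smul]⟩
    obtain ⟨τ, hτ, hτs⟩ : ∃ τ : ℝ, |τ| ≤ 1 ∧ s * τ = |s| := by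
      rcases le_total 0 s with h | h
      · exact ⟨1, by simp, by rw [abs_of_nonneg h, mul_one]⟩
      · exact ⟨-1, by simp, by rw [abs_of_nonpos h]; ring⟩
    -- A shift by `3r/4` leaves room for radius `r/4`. At the new centre the norm is `‖v c‖ + |s|
    -- 3r/4`, and at most `|s| r/4` is lost on the small ball.
    refine ⟨c + (τ * (3 / 4 * r)) • e, ?_, fun x hx => ?_⟩
    · refine Metric.closedBall_subset_closedBall' ?_
      have : |τ| * (3 / 4 * r) ≤ 1 * (3 / 4 * r) := by gcongr
      rw [dist_self_add_left, norm_smul, he, Real.norm_eq_abs, abs_mul, mul_one,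
        abs_of_nonneg (by positivity : 0 ≤ 3 / 4 * r)]
      linarith
    · have h1 : (‖v c‖ + |s| * (3 / 4 * r)) • e =
          v x - s • (x - (c + (τ * (3 / 4 * r)) • e)) := by
        rw [add_smul, ← hve, ← hτs, hv, hv]
        module
      have h2 := norm_sub_le (v x) (s • (x - (c + (τ * (3 / 4 * r)) • e)))
      rw [← h1, norm_smul, norm_smul, he, Real.norm_of_nonneg (by positivity),
        Real.norm_eq_abs, ← dist_eq_norm] at h2
      have h3 := mul_le_mul_of_nonneg_left (Metric.mem_closedBall.1 hx) (abs_nonneg s)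
      linarith

lemma Cell.continuous_weighted (u v : RT0 (d + 1)) :
    Continuous (weighted K (u : Vec (d + 1) → Vec (d + 1)) (v : Vec (d + 1) → Vec (d + 1))) :=
  ((Matrix.toEuclideanLin K⁻¹).continuous_of_finiteDimensional.comp
    (contDiff_of_RT0 u).continuous).inner (contDiff_of_RT0 v).continuous

lemma Cell.norm_basisField_le {c : Vec (d + 1)} {r σ : ℝ} (hr : 0 < r) (hσ : 0 ≤ σ)
    (h : Metric.closedBall c r ⊆ T.set) (hd : Metric.diam T.set ≤ σ * r) (f : Fin (d + 2))
    {x : Vec (d + 1)} (hx : x ∈ T.set) :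
    ‖(T.basisField f : Vec (d + 1) → Vec (d + 1)) x‖ ≤ σ := by
  have h0 := T.height_pos f
  have hT : T.points f ∈ T.set := subset_convexHull ℝ _ (Set.mem_range_self f)
  change ‖(T.height f)⁻¹ • (x - T.points f)‖ ≤ σ
  rw [norm_smul, norm_inv, Real.norm_of_nonneg h0.le, inv_mul_le_iff₀ h0]
  calc _ ≤ σ * r := (T.dist_le_diam hx hT).trans hd
    _ ≤ σ * T.height f := mul_le_mul_of_nonneg_left (T.radius_le_height hr h f) hσ
    _ = _ := mul_comm _ _

/-- On a shape regular simplex the diagonal element form is bounded by the element form. -/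
lemma Cell.diagFluxForm_le_fluxForm (hK : K.PosDef) {c : Vec (d + 1)} {r σ κ m : ℝ} (hr : 0 < r)
    (hσ : 0 ≤ σ) (hκ : 0 < κ) (hm : 0 < m)
    (h : Metric.closedBall c r ⊆ T.set) (hd : Metric.diam T.set ≤ σ * r)
    (hK₁ : ∀ x : Vec (d + 1), m * ‖x‖ ^ 2 ≤ inner ℝ (Matrix.toEuclideanLin K x) x)
    (hK₂ : ∀ x : Vec (d + 1), inner ℝ (Matrix.toEuclideanLin K x) x ≤ κ * m * ‖x‖ ^ 2)
    (v : RT0 (d + 1)) :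
    T.diagFluxForm K v v ≤
      (d + 2) * ((1 + 2 * σ) ^ 2 * σ ^ 2 * (4 * σ) ^ (d + 1) * κ) * T.fluxForm K v v := by
  have hp (x : Vec (d + 1)) : 0 ≤ inner ℝ (Matrix.toEuclideanLin K x) x :=
    le_trans (by positivity) (hK₁ x)
  have hlow (x : Vec (d + 1)) := le_inner_inv hK (by positivity) hp hK₂ x
  have hup (x : Vec (d + 1)) := inner_inv_le hK hm hK₁ x
  obtain ⟨s, hs⟩ := exists_closedBall_le_norm v
  obtain ⟨hs₁, c', hc', hs₂⟩ := hs c r hr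
  -- `t` measures the size of the field: it bounds `v` from below on the small ball and, up to `1 +
  -- 2 σ`, the normal components from above.
  set t := ‖(v : Vec (d + 1) → Vec (d + 1)) c‖ + |s| * (r / 2) with ht
  have ht0 : 0 ≤ t := by positivity
  set b := volume.real (Metric.closedBall c' (r / 4)) with hb
  have hcT : c ∈ T.set := h (Metric.mem_closedBall_self hr.le)
  have hmeas : MeasurableSet T.set := T.isCompact_set.isClosed.measurableSet
  have hfin : volume T.set ≠ ⊤ := T.isCompact_set.measure_lt_top.ne
  have hflux : (κ * m)⁻¹ * t ^ 2 * b ≤ T.fluxForm K v v := by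
    have hw : ∀ x, 0 ≤ weighted K (v : Vec (d + 1) → Vec (d + 1)) v x := fun x =>
      le_trans (by positivity) (hlow _)
    calc _ = ∫ x in Metric.closedBall c' (r / 4), (κ * m)⁻¹ * t ^ 2 := by
          rw [setIntegral_const, smul_eq_mul, mul_comm]
      _ ≤ ∫ x in Metric.closedBall c' (r / 4), weighted K (v : Vec (d + 1) → Vec (d + 1)) v x := by
          refine setIntegral_mono_on (integrableOn_const measure_closedBall_lt_top.ne)
            ((Cell.continuous_weighted v v).continuousOn.integrableOn_compact
              (isCompact_closedBall _ _)) measurableSet_closedBall fun x hx => ?_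
          refine le_trans ?_ (hlow _)
          gcongr
          exact hs₂ x hx
      _ ≤ _ := setIntegral_mono_set (integrableOn_weighted_of_RT0 K v v T)
          (Filter.Eventually.of_forall hw) (hc'.trans h).eventuallyLE
  -- The cell lies in the ball of radius `σ r = 4 σ (r / 4)` about `c`, which explains the factor 4.
  have hvol : volume.real T.set ≤ (4 * σ) ^ (d + 1) * b := by
    refine le_trans (measureReal_mono (s₂ := Metric.closedBall c (Metric.diam T.set))
      (fun x hx => ?_) measure_closedBall_lt_top.ne)
      (volume_real_closedBall_le c c' (by positivity) (by positivity) ?_)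
    · rw [Metric.mem_closedBall, dist_eq_norm]
      exact T.dist_le_diam hx hcT
    · linarith
  have hbasis (f : Fin (d + 2)) : T.fluxForm K (T.basisField f) (T.basisField f) ≤
      m⁻¹ * σ ^ 2 * ((4 * σ) ^ (d + 1) * b) := by
    calc _ ≤ ∫ x in T.set, m⁻¹ * σ ^ 2 := by
          refine setIntegral_mono_on (integrableOn_weighted_of_RT0 K _ _ T)
            (integrableOn_const hfin) hmeas fun x hx => ?_
          refine (hup _).trans ?_
          gcongr
          exact T.norm_basisField_le hr hσ h hd f hx
      _ = m⁻¹ * σ ^ 2 * volume.real T.set := by rw [setIntegral_const, smul_eq_mul, mul_comm]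
      _ ≤ _ := by gcongr
  have hcomp (f : Fin (d + 2)) :
      T.normalComp f v * T.normalComp f v ≤ ((1 + 2 * σ) * t) ^ 2 := by
    have habs : |T.normalComp f v| ≤ (1 + 2 * σ) * t := by
      change |inner ℝ ((v : Vec (d + 1) → Vec (d + 1)) (T.faceOppositeCentroid f)) (T.normal f)| ≤ _
      refine (abs_real_inner_le_norm _ _).trans ?_
      rw [T.norm_normal, mul_one]
      have h1 := hs₁ (T.faceOppositeCentroid f)
      have h2 := (T.dist_le_diam (T.faceOppositeCentroid_mem f) hcT).trans hd
      have h3 := mul_le_mul_of_nonneg_left h2 (abs_nonneg s)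
      have h4 : 0 ≤ σ * ‖(v : Vec (d + 1) → Vec (d + 1)) c‖ := by positivity
      have h5 : 0 ≤ |s| * r := by positivity
      have : (1 + 2 * σ) * t = ‖(v : Vec (d + 1) → Vec (d + 1)) c‖ +
        2 * (σ * ‖(v : Vec (d + 1) → Vec (d + 1)) c‖) + |s| * r / 2 + |s| * (σ * r) := by
        rw [ht]; ring
      linarith
    rw [← sq]
    exact sq_le_sq' (neg_le_of_abs_le habs) (le_of_abs_le habs)
  rw [Cell.diagFluxForm_apply]
  calc _ ≤ ∑ _f : Fin (d + 2),
        ((1 + 2 * σ) * t) ^ 2 * (m⁻¹ * σ ^ 2 * ((4 * σ) ^ (d + 1) * b)) := by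
        refine Finset.sum_le_sum fun f _ => ?_
        exact mul_le_mul (hcomp f) (hbasis f) (T.fluxForm_nonneg hK hp _) (by positivity)
    -- The scale `m` of `K` cancels here and only the anisotropy `κ` survives.
    _ = (d + 2) * ((1 + 2 * σ) ^ 2 * σ ^ 2 * (4 * σ) ^ (d + 1) * κ) *
          ((κ * m)⁻¹ * t ^ 2 * b) := by
        rw [Finset.sum_const, Finset.card_univ, Fintype.card_fin, nsmul_eq_mul]
        push_cast
        field_simp
    _ ≤ _ := by gcongr

end Local

/-! ## Global spaces and forms -/

section Global

variable {n : ℕ} {G : Geometry n} (𝒯 : Discretization G) (P : Params G)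

/-! ### Finite dimension of the discrete spaces. -/

lemma Geometry.isEmpty_I (G : Geometry n) {d : ℕ} (hd : n < d) : IsEmpty (G.I d) := by
  refine ⟨fun i => ?_⟩
  have h := LinearMap.finrank_le_finrank_of_injective
    (f := (G.emb d i).linearIsometry.toLinearMap) (G.emb d i).linearIsometry.injective
  simp only [finrank_euclideanSpace, Fintype.card_fin] at h
  omega

/-- The discrete spaces are products over all `d : ℕ`, but no subdomain has dimension above `n`, so
only finitely many factors are nontrivial. -/
lemma finiteDimensional_pi_nat {F : ℕ → Type*} [∀ d, AddCommGroup (F d)] [∀ d, Module ℝ (F d)]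
    [∀ d, FiniteDimensional ℝ (F d)] (N : ℕ) (h : ∀ d, N < d → Subsingleton (F d)) :
    FiniteDimensional ℝ (∀ d, F d) := by
  let r : (∀ d, F d) →ₗ[ℝ] ∀ d : Fin (N + 1), F d := LinearMap.pi fun d => LinearMap.proj (d : ℕ)
  refine FiniteDimensional.of_injective r fun u v huv => funext fun d => ?_
  rcases lt_or_ge N d with hd | hd
  · have := h d hd
    exact Subsingleton.elim _ _
  · exact congrFun huv ⟨d, by omega⟩

instance : FiniteDimensional ℝ (Broken 𝒯) :=
  finiteDimensional_pi_nat n fun d hd => by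
    have := G.isEmpty_I (show n < d + 1 by omega)
    infer_instance

instance : FiniteDimensional ℝ (Lambdah 𝒯) :=
  finiteDimensional_pi_nat n fun d hd => by
    have := G.isEmpty_I hd
    infer_instance

instance : AddCommGroup (Wh 𝒯) := inferInstanceAs (AddCommGroup (↥(V0h 𝒯) × Lambdah 𝒯))

instance : FiniteDimensional ℝ (Qh 𝒯) :=
  finiteDimensional_pi_nat n fun d hd => by
    have := G.isEmpty_I hd
    infer_instance

/-! ### Symmetry and positivity of the global forms. -/

lemma bulkForm_apply (u v : Broken 𝒯) : bulkForm 𝒯 P u v =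
    ∑ d ∈ Finset.range n, ∑ k : G.I (d + 1), ∑ T : ↥(𝒯.mesh (d + 1) k).cells,
      T.1.fluxForm (P.K d k) (u d k T) (v d k T) := rfl

lemma diagBulkForm_apply (u v : Broken 𝒯) : diagBulkForm 𝒯 P u v =
    ∑ d ∈ Finset.range n, ∑ k : G.I (d + 1), ∑ T : ↥(𝒯.mesh (d + 1) k).cells,
      T.1.diagFluxForm (P.K d k) (u d k T) (v d k T) := rfl

lemma mortarForm_apply (l μ : Lambdah 𝒯) : mortarForm 𝒯 P l μ =
    ∑ d ∈ Finset.range n, ∑ i : G.I d, ∑ j : G.J d i, ∑ M : ↥(𝒯.mortar d i j).cells,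
      P.γ d i j * (P.Kν d i j)⁻¹ * volume.real M.1.set * l d i j M * μ d i j M := rfl

lemma opA_apply (w r : Wh 𝒯) : opA 𝒯 P w r =
    bulkForm 𝒯 P (totalFlux 𝒯 w) (totalFlux 𝒯 r) + mortarForm 𝒯 P w.2 r.2 := rfl

lemma opDA_apply (w r : Wh 𝒯) : opDA 𝒯 P w r =
    diagBulkForm 𝒯 P (totalFlux 𝒯 w) (totalFlux 𝒯 r) + mortarForm 𝒯 P w.2 r.2 := rfl

lemma mortarForm_symm (l μ : Lambdah 𝒯) : mortarForm 𝒯 P l μ = mortarForm 𝒯 P μ l := by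
  simp only [mortarForm_apply, mul_right_comm]

lemma mortarForm_nonneg (μ : Lambdah 𝒯) : 0 ≤ mortarForm 𝒯 P μ μ := by
  rw [mortarForm_apply]
  refine Finset.sum_nonneg fun d _ => Finset.sum_nonneg fun i _ => Finset.sum_nonneg fun j _ =>
    Finset.sum_nonneg fun M _ => ?_
  have h1 := P.γ_pos d i j
  have h2 := P.Kν_pos d i j
  rw [mul_assoc]
  have := mul_self_nonneg (μ d i j M)
  positivity

lemma opA_symm (w r : Wh 𝒯) : opA 𝒯 P w r = opA 𝒯 P r w := by
  rw [opA_apply, opA_apply, mortarForm_symm, bulkForm_apply, bulkForm_apply]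
  congr 1
  exact Finset.sum_congr rfl fun d _ => Finset.sum_congr rfl fun k _ =>
    Finset.sum_congr rfl fun T _ => T.1.fluxForm_symm (P.K_posDef d k) _ _

lemma opDA_symm (w r : Wh 𝒯) : opDA 𝒯 P w r = opDA 𝒯 P r w := by
  rw [opDA_apply, opDA_apply, mortarForm_symm, diagBulkForm_apply, diagBulkForm_apply]
  congr 1
  exact Finset.sum_congr rfl fun d _ => Finset.sum_congr rfl fun k _ =>
    Finset.sum_congr rfl fun T _ => T.1.diagFluxForm_symm _ _

variable {P}

lemma Params.AnisotropyLE.inner_nonneg {κ : ℝ} (hP : P.AnisotropyLE κ) (d : ℕ) (k : G.I (d + 1))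
    (x : Vec (d + 1)) : 0 ≤ inner ℝ (Matrix.toEuclideanLin (P.K d k) x) x := by
  obtain ⟨m, hm, h⟩ := hP d k
  exact le_trans (by positivity) (h x).1

lemma opA_nonneg {κ : ℝ} (hP : P.AnisotropyLE κ) (w : Wh 𝒯) : 0 ≤ opA 𝒯 P w w := by
  rw [opA_apply, bulkForm_apply]
  exact add_nonneg (Finset.sum_nonneg fun d _ => Finset.sum_nonneg fun k _ =>
    Finset.sum_nonneg fun T _ => T.1.fluxForm_nonneg (P.K_posDef d k) (hP.inner_nonneg d k) _)
    (mortarForm_nonneg 𝒯 P _)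

lemma opDA_nonneg {κ : ℝ} (hP : P.AnisotropyLE κ) (w : Wh 𝒯) : 0 ≤ opDA 𝒯 P w w := by
  rw [opDA_apply, diagBulkForm_apply]
  exact add_nonneg (Finset.sum_nonneg fun d _ => Finset.sum_nonneg fun k _ =>
    Finset.sum_nonneg fun T _ => T.1.diagFluxForm_nonneg (P.K_posDef d k) (hP.inner_nonneg d k) _)
    (mortarForm_nonneg 𝒯 P _)

/-- The constant in the equivalence of `A` and `D_A`. -/
noncomputable def equivConst (n : ℕ) (σ κ : ℝ) : ℝ :=
  (n + 2) * ((1 + 2 * (|σ| + 1)) ^ 2 * (|σ| + 1) ^ 2 * (4 * (|σ| + 1)) ^ n * (|κ| + 1))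

/-- Because of this bound one constant serves both comparisons of `A` and `D_A`, including the
common mortar term, which needs only a factor at least 1. -/
lemma add_two_le_equivConst (n : ℕ) (σ κ : ℝ) : (n + 2 : ℝ) ≤ equivConst n σ κ := by
  have h1 := abs_nonneg σ
  have h2 := abs_nonneg κ
  refine le_mul_of_one_le_right (by positivity) ?_
  refine one_le_mul_of_one_le_of_one_le (one_le_mul_of_one_le_of_one_le
    (one_le_mul_of_one_le_of_one_le ?_ ?_) ?_) ?_
  · exact one_le_pow₀ (by linarith)
  · exact one_le_pow₀ (by linarith)
  · exact one_le_pow₀ (by linarith)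
  · linarith

lemma opA_le_opDA {κ : ℝ} (σ : ℝ) (hP : P.AnisotropyLE κ) (w : Wh 𝒯) :
    opA 𝒯 P w w ≤ equivConst n σ κ * opDA 𝒯 P w w := by
  have hβ := add_two_le_equivConst n σ κ
  rw [opA_apply, opDA_apply, mul_add, bulkForm_apply, diagBulkForm_apply]
  refine add_le_add ?_ (le_mul_of_one_le_left (mortarForm_nonneg 𝒯 P _)
    (by linarith [Nat.cast_nonneg (α := ℝ) n]))
  simp only [Finset.mul_sum]
  refine Finset.sum_le_sum fun d hd => Finset.sum_le_sum fun k _ =>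
    Finset.sum_le_sum fun T _ => ?_
  have hd' : (d : ℝ) ≤ n := by exact_mod_cast (Finset.mem_range.1 hd).le
  refine (T.1.fluxForm_le_diagFluxForm (P.K_posDef d k) (hP.inner_nonneg d k) _).trans ?_
  exact mul_le_mul_of_nonneg_right (by linarith)
    (T.1.diagFluxForm_nonneg (P.K_posDef d k) (hP.inner_nonneg d k) _)

variable {𝒯} in
lemma opDA_le_opA {σ κ : ℝ} (hP : P.AnisotropyLE κ) (hT : 𝒯.ShapeRegular σ) (w : Wh 𝒯) :
    opDA 𝒯 P w w ≤ equivConst n σ κ * opA 𝒯 P w w := by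
  have hβ := add_two_le_equivConst n σ κ
  rw [opA_apply, opDA_apply, mul_add, bulkForm_apply, diagBulkForm_apply]
  refine add_le_add ?_ (le_mul_of_one_le_left (mortarForm_nonneg 𝒯 P _)
    (by linarith [Nat.cast_nonneg (α := ℝ) n]))
  simp only [Finset.mul_sum]
  refine Finset.sum_le_sum fun d hd => Finset.sum_le_sum fun k _ =>
    Finset.sum_le_sum fun T _ => ?_
  have hd' : d + 1 ≤ n := Finset.mem_range.1 hd
  have hd'' : (d : ℝ) ≤ n := by exact_mod_cast (Finset.mem_range.1 hd).le
  obtain ⟨m, hm, hK⟩ := hP d k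
  obtain ⟨c, r, hr, hball, hdiam⟩ := hT d k T.1 T.2
  have hσ := le_abs_self σ
  have hκ := le_abs_self κ
  -- Enlarging `σ` and `κ` supplies the positivity that the cell estimate needs, whatever the signs
  -- of the given numbers.
  refine (T.1.diagFluxForm_le_fluxForm (σ := |σ| + 1) (κ := |κ| + 1) (P.K_posDef d k) hr
    (by positivity) (by positivity) hm hball (hdiam.trans (by gcongr; linarith))
    (fun x => (hK x).1) (fun x => (hK x).2.trans (by gcongr; linarith)) _).trans ?_
  refine mul_le_mul_of_nonneg_right ?_
    (T.1.fluxForm_nonneg (P.K_posDef d k) (hP.inner_nonneg d k) _)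
  rw [equivConst]
  -- The base `4 (|σ| + 1)` is at least 1, so the exponent `d + 1` may be raised to `n`.
  gcongr
  linarith [abs_nonneg σ]

end Global

end FracturedFlow

/-! ### Parameter-robust bounds for the fractured flow problem. -/

open FracturedFlow Module in
theorem mainTheorem9 (n : ℕ) (hn : n = 2 ∨ n = 3)
    (σ κ c₁w c₂w c₁p c₂p ρ : ℝ)
    (hc₁w : 0 < c₁w) (hc₂w : 0 < c₂w) (hc₁p : 0 < c₁p) (hc₂p : 0 < c₂p)
    (hρ₀ : 0 ≤ ρ) (hρ₁ : ρ < 1) :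
    ∃ ξ₁ > (0 : ℝ), ∃ ξ₂ > (0 : ℝ),
      ∀ (G : Geometry n) (P : Params G) (𝒯 : Discretization G),
        P.AnisotropyLE κ → 𝒯.ShapeRegular σ →
      ∀ (Hw : Dual ℝ (Wh 𝒯) →ₗ[ℝ] Wh 𝒯) (Hp : Dual ℝ (Qh 𝒯) →ₗ[ℝ] Qh 𝒯),
        IsSPD Hw → IsSPD Hp →
        SpectrallyEquiv c₁w c₂w Hw (opA 𝒯 P) →
        SpectrallyEquiv c₁p c₂p Hp (opS 𝒯 P) →
        (∀ w : Wh 𝒯, opNorm (opA 𝒯 P) (w - Hw (opA 𝒯 P w)) ≤ ρ * opNorm (opA 𝒯 P) w) →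
        Function.Bijective (upperBlock 𝒯 Hw Hp) ∧
        ∀ (x : Wh 𝒯 × Qh 𝒯) (x' : Dual ℝ (Wh 𝒯) × Dual ℝ (Qh 𝒯)),
          x ≠ 0 → x' = upperBlock 𝒯 Hw Hp x →
          ξ₁ ≤ dualInner (precondD 𝒯 Hw Hp) (saddle 𝒯 P (precondU 𝒯 Hw Hp x')) x' /
              dualInner (precondD 𝒯 Hw Hp) x' x' ∧
          dualNorm (precondD 𝒯 Hw Hp) (saddle 𝒯 P (precondU 𝒯 Hw Hp x')) /
              dualNorm (precondD 𝒯 Hw Hp) x' ≤ ξ₂ := by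
  have hβ : 0 < equivConst n σ κ :=
    lt_of_lt_of_le (by positivity) (add_two_le_equivConst n σ κ)
  -- These are the constants of `saddle_fieldOfValues`: the first inverted, since there the norm is
  -- bounded by the numerator, and the second under a root, since there the norms are squared.
  refine ⟨(5 * (2 * c₂w + 2 + c₂p * equivConst n σ κ * c₂w))⁻¹, by positivity,
    √((2 / c₁w + equivConst n σ κ / c₁p) * (2 / c₁w) * (1 + equivConst n σ κ / (c₁w * c₁p)) +
      2 * (equivConst n σ κ / (c₁w * c₁p))),
    Real.sqrt_pos.2 (by positivity), ?_⟩
  intro G P 𝒯 hP hT Hw Hp hHw hHp hw hp hc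
  -- The concrete block operators satisfy the equations of the abstract statement by definition;
  -- only symmetry, positivity and the equivalence of `A` and `D_A` come from the discretization.
  exact saddle_precond_bounds (V := Wh 𝒯) (U := Qh 𝒯) (A := opA 𝒯 P) (D := opDA 𝒯 P)
    (B := opB 𝒯) (Hw := Hw) (Hp := Hp) (C := opBT 𝒯) (R := upperBlock 𝒯 Hw Hp)
    (S := saddle 𝒯 P) (M := precondD 𝒯 Hw Hp) (N := precondU 𝒯 Hw Hp) (L := opS 𝒯 P)
    rfl (fun _ _ => rfl) (fun _ _ => rfl) (fun _ _ => rfl) rfl rfl hβ hc₁w hc₂w hc₁p hc₂p hρ₁.le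
    (opA_symm 𝒯 P) (opDA_symm 𝒯 P) (opA_nonneg 𝒯 hP) (opDA_nonneg 𝒯 hP) (opA_le_opDA 𝒯 σ hP)
    (opDA_le_opA hP hT) hHw hHp hw hp hc
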